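/- Let $q$ be a prime power and let $U_n(\mathbb{F}_q)$ ($n\ge 0$) be the group of all $g\in GL_n(\mathbb{F}_{q^2})$ preserving the Hermitian form $\sum_{i=1}^n x_i\sigma(y_i)$ on $\mathbb{F}_{q^2}^n$, where $\sigma(z)=z^q$. Let $\Phi$ be the set of monic irreducible polynomials in $\mathbb{F}_{q^2}[t]$ other than $t$. A multipartition is a function $\boldsymbol\mu$ from $\Phi$ to partitions with finitely many nonempty values. The type of $g$ is the multipartition $\boldsymbol\mu$ such that, for all $r\in\Phi$ and $i\ge 1$, the number of parts of $\boldsymbol\mu(r)$ equal to $i$ is the multiplicity of $r^i$ as an elementary divisor of the $\mathbb{F}_{q^2}[t]$-module $\mathbb{F}_{q^2}^n$ on which $t$ acts by $g$. The modified type of $g$ is obtained from its type $\boldsymbol\mu$ by subtracting $1$ from every part of $\boldsymbol\mu(t-1)$. For $r=\sum_i a_it^i\in\Phi$ put $r^*=\frac{t^{\deg r}}{\sigma(r(0))}\sum_i\sigma(a_i)t^{-i}\in\Phi$, and call $\boldsymbol\mu$ $*$-invariant if $\boldsymbol\mu(r)=\boldsymbol\mu(r^*)$ for all $r\in\Phi$.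 Let $X_{\boldsymbol\mu,n}\in Z(\mathbb{Z}U_n(\mathbb{F}_q))$ be the sum of all elements of $U_n(\mathbb{F}_q)$ of modified type $\boldsymbol\mu$ (zero if there are none). For $m\in\mathbb{Z}$ let $[m]_{-q}=\frac{(-q)^m-1}{-q-1}$, and let $\mathcal{R}_{-q}$ be the ring of polynomials $f\in\mathbb{Q}[x]$ such that $f([m]_{-q})\in\mathbb{Z}[q^{-1}]$ for all $m\in\mathbb{Z}$. **Theorem.** There are elements $r_{\boldsymbol\mu,\boldsymbol\nu}^{\boldsymbol\lambda}\in\mathcal{R}_{-q}$, indexed by $*$-invariant multipartitions $\boldsymbol\mu,\boldsymbol\nu,\boldsymbol\lambda$ and, for given $\boldsymbol\mu,\boldsymbol\nu$, nonzero for only finitely many $\boldsymbol\lambda$, such that for all $*$-invariant $\boldsymbol\mu,\boldsymbol\nu$ and all $n\ge 0$ $$X_{\boldsymbol\mu,n}X_{\boldsymbol\nu,n}=\sum_{\boldsymbol\lambda} r_{\boldsymbol\mu,\boldsymbol\nu}^{\boldsymbol\lambda}([n]_{-q})\,X_{\boldsymbol\lambda,n},$$ where the sum is over all $*$-invariant multipartitions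 and the equation is read in $\mathbb{Q}U_n(\mathbb{F}_q)$. Moreover, for all $*$-invariant $\boldsymbol\mu,\boldsymbol\nu,\boldsymbol\lambda$ there is a polynomial $p\in\mathbb{Q}[t]$ with $r_{\boldsymbol\mu,\boldsymbol\nu}^{\boldsymbol\lambda}([n]_{-q})=p((-q)^n)$ for all $n\ge 0$. -/

import Mathlib

open Polynomial
open scoped DirectSum

namespace StableUnitary

/-! ### Quantum integer-valued polynomials -/

section QuantumIntegerValued

variable {K : Type*} [Field K]

/-- The quantum integer `[n]_Q = (Q ^ n - 1) / (Q - 1)`, for `n` in `ℤ` and `Q ≠ 1`. -/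
def quantumInt (Q : K) (n : ℤ) : K := (Q ^ n - 1) / (Q - 1)

/-- The ring `ℛ_Q` of quantum integer-valued polynomials: the polynomials `f` over the field `K`
such that `f([n]_Q) ∈ ℤ[Q, Q⁻¹]` for all integers `n`. The formal version is the case where `Q` is
the variable of `K = ℚ(Q)`; here `K = ℚ` and `Q` is minus a prime power. -/
def quantumIntegerValued (Q : K) : Subring K[X] where
  carrier := {f | ∀ n : ℤ, f.eval (quantumInt Q n) ∈ Algebra.adjoin ℤ ({Q, Q⁻¹} : Set K)}
  mul_mem' := fun hf hg n => by
    rw [eval_mul]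
    exact mul_mem (hf n) (hg n)
  one_mem' := fun n => by
    rw [eval_one]
    exact one_mem _
  add_mem' := fun hf hg n => by
    rw [eval_add]
    exact add_mem (hf n) (hg n)
  zero_mem' := fun n => by
    rw [eval_zero]
    exact zero_mem _
  neg_mem' := fun hf n => by
    rw [eval_neg]
    exact neg_mem (hf n)

end QuantumIntegerValued

/-! ### Multipartitions and types of matrices -/

section Types

variable (k : Type*) [Field k]

/-- The monic irreducible polynomials over `k` different from `t`. -/
def MonicIrred : Type _ := {r : k[X] // r.Monic ∧ Irreducible r ∧ r ≠ X}

/-- A partition, given as the multiset of its (positive) parts. -/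
abbrev Partition : Type := Multiset ℕ+

/-- Multipartitions: functions from the monic irreducible polynomials other than `t` to partitions,
with only finitely many nonempty values (so that the size is finite). -/
abbrev Multipartition : Type _ := MonicIrred k →₀ Partition

/-- The polynomial `t - 1`. -/
noncomputable def tSubOne : MonicIrred k :=
  ⟨X - C 1, monic_X_sub_C 1, irreducible_X_sub_C 1, fun h => by
    have := congrArg (eval (0 : k)) h
    simp at this⟩

variable {k}

/-- `A` has type `μ`: for every `r` and `i ≥ 1`, the number `m_i(μ(r))` of parts of `μ(r)` equal to
`i` is the multiplicity of `r ^ i` as an elementary divisor of the `k[t]`-module `k ^ n` on which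
`t` acts by `A`. That is, this module is the direct sum, over all `r` and `i`, of `m_i(μ(r))` copies
of `k[t] / (r ^ i)`. -/
def HasType {n : ℕ} (A : Matrix (Fin n) (Fin n) k) (μ : Multipartition k) : Prop :=
  Nonempty (Module.AEval' (Matrix.toLin' A) ≃ₗ[k[X]]
    ⨁ j : (Σ r : MonicIrred k, Σ i : ℕ+, Fin ((μ r).count i)),
      k[X] ⧸ Ideal.span {(j.1.1 : k[X]) ^ (j.2.1 : ℕ)})

/-- Subtract `1` from every part of a partition, and discard the resulting zeros. -/
def removeFirstColumn (s : Partition) : Partition :=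
  s.filterMap fun i => if 1 < i then some (i - 1) else none

/-- Delete the first column of `μ(t - 1)` and keep `μ(r)` for all other `r`. -/
noncomputable def modify (μ : Multipartition k) : Multipartition k :=
  μ.update (tSubOne k) (removeFirstColumn (μ (tSubOne k)))

/-- `A` has modified type `ν`. -/
def HasModifiedType {n : ℕ} (A : Matrix (Fin n) (Fin n) k) (ν : Multipartition k) : Prop :=
  ∃ μ, HasType A μ ∧ modify μ = ν

/-- Similar matrices have the same types. -/
theorem HasType.conj {n : ℕ} {A : Matrix (Fin n) (Fin n) k} {μ : Multipartition k}
    (h : HasType A μ) (g : GL (Fin n) k) :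
    HasType ((g : Matrix (Fin n) (Fin n) k) * A * ((g⁻¹ : GL (Fin n) k) : Matrix _ _ k)) μ := by
  obtain ⟨e⟩ := h
  set B := (g : Matrix (Fin n) (Fin n) k) * A * ((g⁻¹ : GL (Fin n) k) : Matrix _ _ k) with hB
  have hBg : B * (g : Matrix (Fin n) (Fin n) k) = (g : Matrix (Fin n) (Fin n) k) * A := by
    rw [hB, mul_assoc, ← Units.val_mul, inv_mul_cancel, Units.val_one, mul_one]
  let f : (Fin n → k) ≃ₗ[k] (Fin n → k) := Matrix.toLin'OfInv
    (M := ((g⁻¹ : GL (Fin n) k) : Matrix _ _ k)) (M' := (g : Matrix (Fin n) (Fin n) k))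
    (by rw [← Units.val_mul, inv_mul_cancel, Units.val_one])
    (by rw [← Units.val_mul, mul_inv_cancel, Units.val_one])
  have hf : ∀ v, f v = (g : Matrix (Fin n) (Fin n) k).mulVec v := fun v => Matrix.toLin'_apply _ _
  let φ : Module.AEval' (Matrix.toLin' A) ≃ₗ[k] Module.AEval' (Matrix.toLin' B) :=
    ((Module.AEval'.of (Matrix.toLin' A)).symm.trans f).trans (Module.AEval'.of (Matrix.toLin' B))
  have hX : ∀ m, φ ((X : k[X]) • m) = (X : k[X]) • φ m := by
    intro m
    obtain ⟨v, rfl⟩ := (Module.AEval'.of (Matrix.toLin' A)).surjective m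
    simp only [φ, LinearEquiv.trans_apply, Module.AEval'.X_smul_of, LinearEquiv.symm_apply_apply,
      hf, Matrix.toLin'_apply, Matrix.mulVec_mulVec, hBg]
  have hp : ∀ (p : k[X]) m, φ (p • m) = p • φ m := by
    intro p
    induction p using Polynomial.induction_on' with
    | add p q hp hq => intro m; rw [add_smul, add_smul, map_add, hp, hq]
    | monomial i a =>
      intro m
      have hXi : ∀ m, φ ((X : k[X]) ^ i • m) = (X : k[X]) ^ i • φ m := by
        induction i with
        | zero => intro m; simp
        | succ i ih => intro m; rw [pow_succ, mul_smul, ih, hX, mul_smul]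
      rw [← C_mul_X_pow_eq_monomial, mul_smul, mul_smul, ← hXi]
      rw [← Polynomial.algebraMap_eq, algebraMap_smul, algebraMap_smul, map_smul]
  let ψ : Module.AEval' (Matrix.toLin' A) ≃ₗ[k[X]] Module.AEval' (Matrix.toLin' B) :=
    { φ.toAddEquiv with map_smul' := hp }
  exact ⟨ψ.symm.trans e⟩

theorem HasModifiedType.conj {n : ℕ} {A : Matrix (Fin n) (Fin n) k} {ν : Multipartition k}
    (h : HasModifiedType A ν) (g : GL (Fin n) k) :
    HasModifiedType
      ((g : Matrix (Fin n) (Fin n) k) * A * ((g⁻¹ : GL (Fin n) k) : Matrix _ _ k)) ν := by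
  obtain ⟨μ, hμ, hν⟩ := h
  exact ⟨μ, hμ.conj g, hν⟩

end Types

/-! ### Unitary groups

Here `k` is a finite field with `q ^ 2` elements (so that `q` is a prime power), and
`σ(x) = x ^ q`. -/

section Unitary

variable {k : Type*} [Field k]

/-- The standard Hermitian form `∑ x_i σ(y_i)` on `k ^ n`. -/
def hermitianForm (q : ℕ) {n : ℕ} (x y : Fin n → k) : k := ∑ i, x i * y i ^ q

variable (k)

/-- The unitary group `U_n(𝔽_q)`: the elements of `GL_n(k)` preserving the Hermitian form. -/
def unitaryGrp (q n : ℕ) : Subgroup (GL (Fin n) k) where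
  carrier := {g | ∀ v w : Fin n → k, hermitianForm q
    ((g : Matrix (Fin n) (Fin n) k).mulVec v) ((g : Matrix (Fin n) (Fin n) k).mulVec w) =
      hermitianForm q v w}
  mul_mem' := fun {a b} ha hb v w => by
    rw [Units.val_mul, ← Matrix.mulVec_mulVec, ← Matrix.mulVec_mulVec, ha, hb]
  one_mem' := fun v w => by rw [Units.val_one, Matrix.one_mulVec, Matrix.one_mulVec]
  inv_mem' := fun {a} ha v w => by
    rw [← ha, Matrix.mulVec_mulVec, Matrix.mulVec_mulVec, ← Units.val_mul, mul_inv_cancel,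
      Units.val_one, Matrix.one_mulVec, Matrix.one_mulVec]

variable {k}

/-- The polynomial `r* = t ^ deg(r) / σ(r(0)) * ∑ σ(a_i) t ^ (-i)`, for `r = ∑ a_i t ^ i`. -/
noncomputable def starPoly (q : ℕ) (r : k[X]) : k[X] :=
  C ((r.coeff 0 ^ q)⁻¹) *
    ∑ i ∈ Finset.range (r.natDegree + 1), C (r.coeff i ^ q) * X ^ (r.natDegree - i)

/-- Invariance under `*`: `μ(r) = μ(r*)` for all `r`. -/
def IsStarInvariant (q : ℕ) (μ : Multipartition k) : Prop :=
  ∀ r s : MonicIrred k, s.1 = starPoly q r.1 → μ r = μ s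

variable (k)

/-- The multipartitions invariant under `*`. -/
abbrev StarMultipartition (q : ℕ) : Type _ := {μ : Multipartition k // IsStarInvariant q μ}

variable {k} [Finite k]

/-- The sum of all elements of modified type `ν` in `U_n(𝔽_q)`, in the integral group ring. -/
noncomputable def modifiedTypeSum (q n : ℕ) (ν : Multipartition k) :
    MonoidAlgebra ℤ (unitaryGrp k q n) :=
  ∑ g ∈ (Set.toFinite {g : unitaryGrp k q n |
    HasModifiedType ((g : GL (Fin n) k) : Matrix (Fin n) (Fin n) k) ν}).toFinset,
    MonoidAlgebra.of ℤ _ g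

theorem modifiedTypeSum_mem_center (q n : ℕ) (ν : Multipartition k) :
    modifiedTypeSum q n ν ∈ Subring.center (MonoidAlgebra ℤ (unitaryGrp k q n)) := by
  rw [Subring.mem_center_iff]
  intro x
  induction x using MonoidAlgebra.induction_on with
  | of h =>
    unfold modifiedTypeSum
    rw [Finset.mul_sum, Finset.sum_mul]
    refine Finset.sum_bij' (fun g _ => h * g * h⁻¹) (fun g _ => h⁻¹ * g * h) ?_ ?_ ?_ ?_ ?_
    · intro g hg
      simp only [Set.Finite.mem_toFinset, Set.mem_ofPred_eq] at hg ⊢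
      exact hg.conj (h : GL (Fin n) k)
    · intro g hg
      simp only [Set.Finite.mem_toFinset, Set.mem_ofPred_eq] at hg ⊢
      have := hg.conj ((h⁻¹ : unitaryGrp k q n) : GL (Fin n) k)
      simpa using this
    · intro g _
      group
    · intro g _
      group
    · intro g _
      rw [← map_mul, ← map_mul]
      congr 1
      group
  | add x y hx hy => rw [add_mul, mul_add, hx, hy]
  | smul a x hx => rw [smul_mul_assoc, mul_smul_comm, hx]

/-- `X_{ν, n}`: the sum of all elements of modified type `ν` in `U_n(𝔽_q)`, as an element of
the centre `Z(ℤU_n(𝔽_q))`. -/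
noncomputable def classSum (q n : ℕ) (ν : Multipartition k) :
    Subring.center (MonoidAlgebra ℤ (unitaryGrp k q n)) :=
  ⟨modifiedTypeSum q n ν, modifiedTypeSum_mem_center q n ν⟩

end Unitary

/-- The inclusion of `Z(ℤG)` into `ℚG`. -/
noncomputable def centerToRat (G : Type*) [Group G] :
    Subring.center (MonoidAlgebra ℤ G) →+* MonoidAlgebra ℚ G :=
  (MonoidAlgebra.mapRingHom G (Int.castRingHom ℚ)).comp (Subring.subtype _)

end StableUnitary

/-! The coefficient of `z` in a product of class sums is the number of unitary `g` of modified type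
`μ` with `g⁻¹ * z` of modified type `ν` (`factorCount`). This number depends only on `n` and the
modified type `l` of `z`, because similar unitary matrices are unitarily similar
(`exists_unitary_conj`): if `P * g = h * P`, then `Pᴴ * P` commutes with `g` and equals `yᴴ * y` for
a polynomial `y` in it, and `P * y⁻¹` is a unitary conjugator. The existence of `y` is surjectivity
of the norm for a finite commutative ring with unramified involution (`exists_norm_eq`).

Modified types are encoded by the ranks of `(g - 1) * p(g)`, which do not change when an identity
block is added. So `z` can be fixed of the least possible size `a`, and the factorisations of `z ⊕
1` are counted, with `1` of size `m = n - a`. Write `g = 1 + f * x * fᴴ` with `f = 1 ⊕ v`, where the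
columns of `v` are a basis of the range of the last `m` rows of `g - 1`. Every condition on `g`
becomes a condition on `x` and the Gram matrix `vᴴ * v` in which `m` does not occur
(`isFactor_frame_iff`), and `v` has at most `multiSize μ` columns. Only the number of injective `v`
with given Gram matrix varies with `m`.

Fourier expansion writes the number of all `v` with Gram matrix `H` as an average over matrices `B`
of a phase times the `m`-th power of an exponential sum of a sesquilinear form. Each such sum is a
power of `-q` (`exists_sum_addChar_eq`), so the count is a polynomial in `(-q) ^ m`; induction on
the number of columns passes to injective `v`. As `(-q) ^ m = (-q) ^ (-a) * (-q) ^ n`, the structure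
constants are polynomials in `[n]`.

These polynomials are integral at all `n ≥ a`. The powers of `Q = -q` are periodic modulo a common
denominator once `Q` is inverted, which carries integrality to all integers
(`mem_quantumIntegerValued_of_forall_ge`). Only finitely many `l` occur because `z - 1` has rank at
most `multiSize μ + multiSize ν`. -/

namespace StableUnitary

/-! ### The field with `q ^ 2` elements, its norm and its characters -/

section FiniteField

variable {k : Type*} [Field k] [Fintype k]

theorem two_le_of_card {q : ℕ} (hk : Fintype.card k = q ^ 2) : 2 ≤ q := by
  have h := Fintype.one_lt_card (α := k)
  by_contra! hq
  interval_cases q <;> simp_all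

theorem sum_eq_apply_zero_add_sum_units [DecidableEq k] {M : Type*} [AddCommMonoid M]
    (F : k → M) : ∑ c, F c = F 0 + ∑ u : kˣ, F u := by
  rw [Fintype.sum_eq_add_sum_subtype_ne F 0]
  congr 1
  exact (Fintype.sum_equiv unitsEquivNeZero _ _ fun _ => rfl).symm

/-- The `q`-power map is a ring endomorphism of a field with `q ^ 2` elements. -/
theorem exists_ringHom_pow {q : ℕ} (hk : Fintype.card k = q ^ 2) :
    ∃ φ : k →+* k, ∀ x, φ x = x ^ q := by
  obtain ⟨p, hp⟩ := CharP.exists k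
  obtain ⟨n, hpp, hn⟩ := FiniteField.card k p
  have : Fact p.Prime := ⟨hpp⟩
  have hd : q ∣ p ^ (n : ℕ) := by rw [← hn, hk]; exact dvd_pow_self q two_ne_zero
  obtain ⟨f, -, hf⟩ := (Nat.dvd_prime_pow hpp).1 hd
  exact ⟨iterateFrobenius k p f, fun x => by rw [iterateFrobenius_def, hf]⟩

/-- The star ring structure given by the `q`-power map on a field with `q ^ 2` elements. -/
@[reducible] noncomputable def starRingOfCard {q : ℕ} (hk : Fintype.card k = q ^ 2) :
    StarRing k where
  star x := x ^ q
  star_involutive x := by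
    change (x ^ q) ^ q = x
    rw [← pow_mul, ← sq, ← hk, FiniteField.pow_card]
  star_mul x y := by
    change (x * y) ^ q = y ^ q * x ^ q
    rw [mul_pow, mul_comm]
  star_add x y := by
    obtain ⟨φ, hφ⟩ := exists_ringHom_pow hk
    change (x + y) ^ q = x ^ q + y ^ q
    rw [← hφ, ← hφ, ← hφ, map_add]

variable [StarRing k] {q : ℕ}

theorem exists_star_sub_self_ne_zero (hk : Fintype.card k = q ^ 2)
    (hs : ∀ x : k, star x = x ^ q) : ∃ t : k, t - star t ≠ 0 := by
  by_contra! h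
  have hq := two_le_of_card hk
  have h1 : (X ^ q - X : k[X]) ≠ 0 := FiniteField.X_pow_card_sub_X_ne_zero k (by omega)
  have h2 := Polynomial.card_le_degree_of_subset_roots (p := (X ^ q - X : k[X]))
    (Z := Finset.univ) (by
      intro x _
      rw [mem_roots h1]
      simp only [IsRoot, eval_sub, eval_pow, eval_X]
      rw [← hs, ← neg_sub, h, neg_zero])
  rw [FiniteField.X_pow_card_sub_X_natDegree_eq k (by omega), Finset.card_univ, hk] at h2
  nlinarith

/-- Outside characteristic two `t = 1` works; in characteristic two the sum is a difference. -/
theorem exists_add_star_ne_zero (hk : Fintype.card k = q ^ 2)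
    (hs : ∀ x : k, star x = x ^ q) : ∃ t : k, t + star t ≠ 0 := by
  by_contra! h
  obtain ⟨t, ht⟩ := exists_star_sub_self_ne_zero hk hs
  have h1 := h 1
  have h2 := h t
  rw [star_one] at h1
  apply ht
  linear_combination h2 * 1 - star t * h1

/-- Compose any suitable character with the trace `x + star x`. Evaluated on a sesquilinear form,
the result sees only its Hermitian part. -/
theorem exists_addChar_star_invariant (hk : Fintype.card k = q ^ 2)
    (hs : ∀ x : k, star x = x ^ q) :
    ∃ ψ : AddChar k ℂ, ψ ≠ 1 ∧ (∀ x, ψ (star x) = ψ x) ∧ ∀ x, x + star x = 0 → ψ x = 1 := by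
  obtain ⟨t, ht⟩ := exists_add_star_ne_zero hk hs
  obtain ⟨ψ, hψ⟩ := AddChar.exists_apply_ne_zero.2 ht
  refine ⟨ψ.compAddMonoidHom (AddMonoidHom.id k + (starAddEquiv : k ≃+ k).toAddMonoidHom),
    ?_, ?_, ?_⟩
  · rw [AddChar.ne_one_iff]
    exact ⟨t, by simpa using hψ⟩
  · intro x
    simp [add_comm]
  · intro x hx
    simp [hx]

theorem star_eq_self_iff_of_unit (hk : Fintype.card k = q ^ 2)
    (hs : ∀ x : k, star x = x ^ q) (v : kˣ) : star (v : k) = v ↔ v ^ (q - 1) = 1 := by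
  have hq := two_le_of_card hk
  rw [hs]
  obtain ⟨s, rfl⟩ : ∃ s, q = s + 1 := ⟨q - 1, by omega⟩
  rw [pow_succ, Nat.add_sub_cancel, Units.ext_iff]
  constructor
  · intro h
    have := mul_right_cancel₀ v.ne_zero (h.trans (one_mul _).symm)
    simpa using this
  · intro h
    rw [Units.val_pow_eq_pow_val] at h
    rw [h, Units.val_one, one_mul]

/-- The unit group is cyclic of order `(q - 1) * (q + 1)`. The image of the norm and the group of
`star`-fixed units both have order `q - 1`, so they agree, and the fibres over the image are cosets
of the kernel, of order `q + 1`. -/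
theorem card_norm_fiber (hk : Fintype.card k = q ^ 2) [DecidableEq k]
    (hs : ∀ x : k, star x = x ^ q) (v : kˣ) :
    (Finset.univ.filter fun u : kˣ => u ^ (q + 1) = v).card =
      if star (v : k) = v then q + 1 else 0 := by
  have hq := two_le_of_card hk
  have hcard : Nat.card kˣ = (q - 1) * (q + 1) := by
    rw [Nat.card_eq_fintype_card, Fintype.card_units, hk]
    obtain ⟨s, rfl⟩ : ∃ s, q = s + 1 := ⟨q - 1, by omega⟩
    simp only [Nat.add_sub_cancel]
    have : (s + 1) ^ 2 = s * (s + 1 + 1) + 1 := by ring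
    omega
  have hr := IsCyclic.card_powMonoidHom_range kˣ (q + 1)
  rw [hcard, Nat.gcd_eq_right (Dvd.intro_left _ rfl), Nat.mul_div_cancel _ (by omega)] at hr
  have hker := IsCyclic.card_powMonoidHom_ker kˣ (q + 1)
  rw [hcard, Nat.gcd_eq_right (Dvd.intro_left _ rfl)] at hker
  have hker' := IsCyclic.card_powMonoidHom_ker kˣ (q - 1)
  rw [hcard, Nat.gcd_eq_right (Dvd.intro _ rfl)] at hker'
  have hle : (powMonoidHom (q + 1) : kˣ →* kˣ).range ≤ (powMonoidHom (q - 1) : kˣ →* kˣ).ker := by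
    rintro _ ⟨u, rfl⟩
    rw [MonoidHom.mem_ker, powMonoidHom_apply, powMonoidHom_apply, ← pow_mul, mul_comm, ← hcard,
      pow_card_eq_one']
  have heq := Subgroup.eq_of_le_of_card_ge hle (by rw [hr, hker'])
  have hmem : star (v : k) = v ↔ v ∈ (powMonoidHom (q + 1) : kˣ →* kˣ).range := by
    rw [star_eq_self_iff_of_unit hk hs, heq, MonoidHom.mem_ker, powMonoidHom_apply]
  split_ifs with h
  · have h1 : v ∈ Set.range (powMonoidHom (q + 1) : kˣ →* kˣ) := hmem.1 h
    have h2 : (1 : kˣ) ∈ Set.range (powMonoidHom (q + 1) : kˣ →* kˣ) := ⟨1, map_one _⟩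
    have := MonoidHom.card_fiber_eq_of_mem_range (powMonoidHom (q + 1) : kˣ →* kˣ) h1 h2
    simp only [powMonoidHom_apply] at this
    refine this.trans (Eq.trans ?_ hker)
    rw [Nat.card_eq_fintype_card, Fintype.card_subtype]
    simp only [MonoidHom.mem_ker, powMonoidHom_apply]
  · rw [Finset.card_eq_zero, Finset.filter_eq_empty_iff]
    intro u _ hu
    exact h (hmem.2 ⟨u, hu⟩)

/-- On the fixed field, `t ↦ ψ (t * a)` is nontrivial (look at `t = 1`), so it sums to `0`, and to
`-1` over nonzero `t`. Each nonzero `t` is a norm `q + 1` times, which gives `1 + (q + 1) * (-1) =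
-q`. -/
theorem sum_addChar_norm (hk : Fintype.card k = q ^ 2)
    (hs : ∀ x : k, star x = x ^ q) (ψ : AddChar k ℂ) (a : k) (ha : ψ a ≠ 1) :
    ∑ c, ψ (star c * c * a) = -(q : ℂ) := by
  classical
  have hz : ∑ t : k, (if star t = t then ψ (t * a) else 0) = 0 := by
    let K : AddSubgroup k :=
      { carrier := {t | star t = t}
        add_mem' := by
          intro x y hx hy
          rw [Set.mem_ofPred_eq] at *
          rw [star_add, hx, hy]
        zero_mem' := by simp
        neg_mem' := by
          intro x hx
          rw [Set.mem_ofPred_eq] at *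
          rw [star_neg, hx] }
    let χ : AddChar K ℂ := ψ.compAddMonoidHom ((AddMonoidHom.mulRight a).comp K.subtype)
    have h1 : χ ≠ 1 := by
      rw [AddChar.ne_one_iff]
      exact ⟨⟨1, by simp [K]⟩, by simpa [χ] using ha⟩
    have h2 := AddChar.sum_eq_zero_of_ne_one h1
    rw [← Finset.sum_filter]
    refine Eq.trans ?_ h2
    exact Finset.sum_subtype _ (by simp [K]) _
  rw [sum_eq_apply_zero_add_sum_units] at hz ⊢
  have hN : ∀ u : kˣ, ψ (star (u : k) * u * a) = ψ (((u ^ (q + 1) : kˣ) : k) * a) := by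
    intro u
    rw [hs, ← pow_succ, Units.val_pow_eq_pow_val]
  simp_rw [hN]
  have hf : ∑ u : kˣ, ψ (((u ^ (q + 1) : kˣ) : k) * a) =
      (q + 1) * ∑ v : kˣ, (if star (v : k) = v then ψ (v * a) else 0) := by
    rw [← Finset.sum_fiberwise (s := Finset.univ) (g := fun u : kˣ => u ^ (q + 1)), Finset.mul_sum]
    refine Finset.sum_congr rfl fun v _ => ?_
    rw [Finset.sum_congr rfl (g := fun _ => ψ ((v : k) * a)), Finset.sum_const,
      card_norm_fiber hk hs]
    · split_ifs <;> simp
    · intro u hu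
      rw [(Finset.mem_filter.1 hu).2]
  rw [hf]
  simp only [star_zero, if_true, zero_mul, AddChar.map_zero_eq_one] at hz ⊢
  linear_combination ((q : ℂ) + 1) * hz

end FiniteField

/-! ### Exponential sums of sesquilinear forms -/

section HermitianSum

variable {k : Type*} [Field k] [Fintype k] [StarRing k] {q : ℕ}

/-- The exponential sum of a sesquilinear form is a power of `-q`. -/
theorem exists_sum_addChar_eq (hk : Fintype.card k = q ^ 2) (hs : ∀ x : k, star x = x ^ q)
    (ψ : AddChar k ℂ) (hψ : ∀ x, ψ (star x) = ψ x)
    (hψ' : ∀ x, x + star x = 0 → ψ x = 1) (n : ℕ) :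
    ∀ (V : Type _) [AddCommGroup V] [Module k V] [Fintype V],
      Module.finrank k V = n → ∀ h : V →ₗ⋆[k] V →ₗ[k] k,
      ∃ j : ℕ, ∑ x : V, ψ (h x x) = (-(q : ℂ)) ^ j := by
  classical
  induction n with
  | zero =>
    intro V _ _ _ hV h
    have : Subsingleton V := Module.finrank_zero_iff.1 hV
    refine ⟨0, ?_⟩
    rw [Fintype.sum_subsingleton _ 0]
    simp
  | succ n ih =>
    intro V _ _ _ hV h
    -- If every term is `1`, the sum is the cardinality `q ^ (2 * (n + 1))`, an even power of `-q`.
    -- Otherwise an anisotropic line is split off.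
    by_cases htriv : ∀ x, ψ (h x x) = 1
    · refine ⟨2 * (n + 1), ?_⟩
      simp only [htriv, Finset.sum_const, Finset.card_univ, nsmul_eq_mul, mul_one]
      rw [Module.card_eq_pow_finrank (K := k) (V := V), hk, hV, pow_mul (-(q : ℂ)), neg_sq]
      push_cast
      ring
    push Not at htriv
    obtain ⟨e, he⟩ := htriv
    -- Pairing with `e` under the Hermitian form attached to `h`. Here `l e ≠ 0`, so `V` is the line
    -- of `e` plus its orthogonal complement `ker l`.
    let l : V →ₗ[k] k :=
      { toFun := fun w => h e w + star (h w e)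
        map_add' := by intro x y; simp; ring
        map_smul' := by intro c x; simp [starRingEnd_apply]; ring }
    have hl : ∀ w, l w = h e w + star (h w e) := fun _ => rfl
    have hle : l e ≠ 0 := by
      intro h0
      rw [hl] at h0
      exact he (hψ' _ h0)
    let W := LinearMap.ker l
    have hW : Module.finrank k W = n := by
      have := Module.Dual.finrank_ker_add_one_of_ne_zero (f := l) (by rintro h0; simp [h0] at hle)
      rw [hV] at this
      exact Nat.succ_injective this
    have hE : Function.Bijective fun p : k × W => p.1 • e + (p.2 : V) := by
      constructor
      · rintro ⟨c, w⟩ ⟨c', w'⟩ hcc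
        have h1 : c • e + (w : V) = c' • e + (w' : V) := hcc
        have h2 := congrArg l h1
        simp only [map_add, map_smul, smul_eq_mul, LinearMap.mem_ker.1 w.2,
          LinearMap.mem_ker.1 w'.2, add_zero] at h2
        have h3 := mul_right_cancel₀ hle h2
        subst h3
        simpa using h1
      · intro v
        refine ⟨⟨l v / l e, ⟨v - (l v / l e) • e, ?_⟩⟩, by simp⟩
        rw [LinearMap.mem_ker, map_sub, map_smul, smul_eq_mul, div_mul_cancel₀ _ hle, sub_self]
    obtain ⟨j, hj⟩ := ih W hW (h.domRestrict₁₂ W W)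
    refine ⟨j + 1, ?_⟩
    rw [← hE.sum_comp, Fintype.sum_prod_type, pow_succ, ← hj,
      ← sum_addChar_norm hk hs ψ _ he, mul_comm, Finset.sum_mul_sum]
    refine Finset.sum_congr rfl fun c _ => Finset.sum_congr rfl fun w _ => ?_
    have hw : h e w + star (h w e) = 0 := w.2
    simp only [LinearMap.domRestrict₁₂_apply,
      map_add, LinearMap.add_apply, map_smul, LinearMap.map_smulₛₗ, LinearMap.smul_apply,
      smul_eq_mul, starRingEnd_apply, AddChar.map_add_eq_mul]
    -- The cross terms cancel by invariance of `ψ` under `star` and orthogonality of `w` to `e`. So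
    -- the sum is `-q` from the line times the sum over `W`.
    have h4 : ψ (star c * h e w) * ψ (c * h w e) = 1 := by
      rw [← hψ (c * h w e), star_mul', ← AddChar.map_add_eq_mul, ← mul_add, hw, mul_zero,
        AddChar.map_zero_eq_one]
    have h5 : c * (star c * h e e + h w e) = star c * c * h e e + c * h w e := by ring
    rw [h5, AddChar.map_add_eq_mul]
    linear_combination (ψ (star c * c * h e e) * ψ (h w w)) * h4

end HermitianSum

/-! ### Counting matrices with given Gram matrix -/

section GramCount

/-- `F m` is a polynomial in `(-q) ^ m`. -/
def IsPolyInPow (q : ℕ) (F : ℕ → ℂ) : Prop :=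
  ∃ p : ℂ[X], ∀ m, F m = p.eval ((-(q : ℂ)) ^ m)

variable {q : ℕ}

theorem IsPolyInPow.congr {F G : ℕ → ℂ} (hF : IsPolyInPow q F) (h : ∀ m, G m = F m) :
    IsPolyInPow q G := by
  obtain ⟨p, hp⟩ := hF
  exact ⟨p, fun m => (h m).trans (hp m)⟩

theorem IsPolyInPow.const_mul {F : ℕ → ℂ} (hF : IsPolyInPow q F) (c : ℂ) :
    IsPolyInPow q fun m => c * F m := by
  obtain ⟨p, hp⟩ := hF
  exact ⟨C c * p, fun m => by simp [hp]⟩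

theorem IsPolyInPow.sub {F G : ℕ → ℂ} (hF : IsPolyInPow q F) (hG : IsPolyInPow q G) :
    IsPolyInPow q fun m => F m - G m := by
  obtain ⟨p, hp⟩ := hF
  obtain ⟨p', hp'⟩ := hG
  exact ⟨p - p', fun m => by simp [hp, hp']⟩

theorem IsPolyInPow.sum {ι : Type*} (s : Finset ι) {F : ι → ℕ → ℂ}
    (hF : ∀ i ∈ s, IsPolyInPow q (F i)) : IsPolyInPow q fun m => ∑ i ∈ s, F i m := by
  classical
  choose! p hp using hF
  refine ⟨∑ i ∈ s, p i, fun m => ?_⟩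
  rw [eval_finsetSum]
  exact Finset.sum_congr rfl fun i hi => hp i hi m

variable (q) in
theorem isPolyInPow_pow (j : ℕ) : IsPolyInPow q fun m => ((-(q : ℂ)) ^ j) ^ m :=
  ⟨X ^ j, fun m => by simp only [eval_pow, eval_X]; rw [← pow_mul, ← pow_mul, mul_comm]⟩

theorem sum_addChar_trace_mul {k : Type*} [Field k] [Fintype k] {d : Type*} [Fintype d]
    [DecidableEq d] [DecidableEq k]
    (ψ : AddChar k ℂ) (hψ : ψ ≠ 1) (A : Matrix d d k) :
    ∑ B : Matrix d d k, ψ ((B * A).trace) =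
      if A = 0 then (Fintype.card (Matrix d d k) : ℂ) else 0 := by
  split_ifs with h
  · simp [h]
  · let χ : AddChar (Matrix d d k) ℂ := ψ.compAddMonoidHom
      ((Matrix.traceAddMonoidHom d k).comp (AddMonoidHom.mulRight A))
    refine AddChar.sum_eq_zero_of_ne_one (ψ := χ) ?_
    obtain ⟨t, ht⟩ := AddChar.ne_one_iff.1 hψ
    obtain ⟨i, j, hij⟩ : ∃ i j, A i j ≠ 0 := by
      by_contra! h0
      exact h (Matrix.ext h0)
    rw [AddChar.ne_one_iff]
    refine ⟨Matrix.single j i (t / A i j), ?_⟩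
    have : (Matrix.single j i (t / A i j) * A).trace = t := by
      rw [Matrix.trace_single_mul, smul_eq_mul, div_mul_cancel₀ _ hij]
    simpa [χ, this] using ht

variable {k : Type*} [Field k] [StarRing k]

/-- The sesquilinear form of a matrix. -/
def sesqForm {d : Type*} [Fintype d] (B : Matrix d d k) : (d → k) →ₗ⋆[k] (d → k) →ₗ[k] k :=
  LinearMap.mk₂'ₛₗ (starRingEnd k) (RingHom.id k) (fun x y => star x ⬝ᵥ B.mulVec y)
    (fun x y z => by rw [star_add, add_dotProduct])
    (fun c x y => by rw [star_smul, smul_dotProduct]; rfl)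
    (fun x y z => by rw [Matrix.mulVec_add, dotProduct_add])
    (fun c x y => by rw [Matrix.mulVec_smul, dotProduct_smul]; rfl)

/-- Cycling `v` to the front makes the trace a sum over the rows of `v`, so its character value is a
product over independent rows. The transpose appears because rows are fed to a form that conjugates
its first argument. -/
theorem trace_mul_conjTranspose_mul {d ι : Type*} [Fintype d] [Fintype ι] (B : Matrix d d k)
    (v : Matrix ι d k) :
    (B * (v.conjTranspose * v)).trace = ∑ i, sesqForm B.transpose (v i) (v i) := by
  rw [← Matrix.mul_assoc, Matrix.trace_mul_cycle]
  refine Finset.sum_congr rfl fun i _ => ?_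
  rw [sesqForm, LinearMap.mk₂'ₛₗ_apply, Matrix.mulVec_transpose, dotProduct_comm]
  rfl

theorem addChar_sum {A ι M : Type*} [AddCommMonoid A] [CommMonoid M] (ψ : AddChar A M)
    (s : Finset ι) (f : ι → A) : ψ (∑ i ∈ s, f i) = ∏ i ∈ s, ψ (f i) := by
  classical
  induction s using Finset.induction_on with
  | empty => simp
  | insert a s ha ih => rw [Finset.sum_insert ha, Finset.prod_insert ha, AddChar.map_add_eq_mul, ih]

/-- The number of `m × d` matrices with given Gram matrix is a polynomial in `(-q) ^ m`. -/
theorem isPolyInPow_card_gram [Fintype k] (hk : Fintype.card k = q ^ 2)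
    (hs : ∀ x : k, star x = x ^ q)
    {d : Type} [Fintype d] [DecidableEq d] (H : Matrix d d k) :
    IsPolyInPow q fun m =>
      (Nat.card {v : Matrix (Fin m) d k // v.conjTranspose * v = H} : ℂ) := by
  classical
  obtain ⟨ψ, hψ, hψ1, hψ2⟩ := exists_addChar_star_invariant hk hs
  choose j hj using fun B : Matrix d d k => exists_sum_addChar_eq hk hs ψ hψ1 hψ2
    _ (d → k) rfl (sesqForm B.transpose)
  have key := IsPolyInPow.const_mul (IsPolyInPow.sum (Finset.univ : Finset (Matrix d d k))
    fun B _ => (isPolyInPow_pow q (j B)).const_mul (ψ (-(B * H).trace)))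
    ((Fintype.card (Matrix d d k) : ℂ)⁻¹)
  refine key.congr fun m => ?_
  rw [Nat.card_eq_fintype_card, Fintype.card_subtype, Finset.card_filter]
  push_cast
  rw [eq_inv_mul_iff_mul_eq₀ (Nat.cast_ne_zero.2 Fintype.card_ne_zero), Finset.mul_sum]
  -- Orthogonality of characters detects the condition `vᴴ * v = H`.
  have h1 : ∀ v : Matrix (Fin m) d k, (Fintype.card (Matrix d d k) : ℂ) *
      (if v.conjTranspose * v = H then 1 else 0) =
      ∑ B : Matrix d d k, ψ (-(B * H).trace) * ∏ i, ψ (sesqForm B.transpose (v i) (v i)) := by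
    intro v
    have := sum_addChar_trace_mul ψ hψ (v.conjTranspose * v - H)
    simp only [sub_eq_zero] at this
    rw [mul_ite, mul_one, mul_zero, ← this]
    refine Finset.sum_congr rfl fun B _ => ?_
    rw [Matrix.mul_sub, Matrix.trace_sub, trace_mul_conjTranspose_mul, sub_eq_neg_add,
      AddChar.map_add_eq_mul, addChar_sum]
  rw [Finset.sum_congr rfl fun v _ => h1 v, Finset.sum_comm]
  refine Finset.sum_congr rfl fun B _ => ?_
  -- The sum over `v` of a product over its `m` rows is the `m`-th power of the sum over one row.
  rw [← Finset.mul_sum, ← hj B, Fintype.sum_pow]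
  rfl

end GramCount
-- Counting by fibres, one-sided inverses and ranks
section Counting

theorem card_eq_sum_card_fiber {A : Type*} [Finite A] (f : A → ℕ) (N : ℕ) (h : ∀ a, f a < N) :
    Nat.card A = ∑ r ∈ Finset.range N, Nat.card {a // f a = r} := by
  classical
  have := Fintype.ofFinite A
  rw [Nat.card_eq_fintype_card, ← Finset.card_univ,
    Finset.card_eq_sum_card_fiberwise (f := f) (t := Finset.range N) (by simpa using h)]
  refine Finset.sum_congr rfl fun r _ => ?_
  rw [Nat.card_eq_fintype_card, Fintype.card_subtype]

theorem card_eq_mul_of_card_fiber {A B : Type*} [Finite A] [Finite B] (f : B → A) (c : ℕ)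
    (h : ∀ a, Nat.card {b // f b = a} = c) : Nat.card B = Nat.card A * c := by
  have := Fintype.ofFinite A
  rw [← Nat.card_congr (Equiv.sigmaFiberEquiv f), Nat.card_sigma]
  simp [h]

end Counting

section LeftInverse

variable {k : Type*} [Field k]

theorem exists_eq_mul_of_range_le {ι κ μ : Type*} [Fintype κ] [Fintype μ] [DecidableEq μ]
    {A : Matrix ι μ k} {B : Matrix ι κ k}
    (h : LinearMap.range A.mulVecLin ≤ LinearMap.range B.mulVecLin) :
    ∃ P : Matrix κ μ k, A = B * P := by
  have h1 : ∀ j, ∃ y, B.mulVecLin y = A.mulVecLin (Pi.single j 1) := fun j => h ⟨_, rfl⟩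
  choose y hy using h1
  refine ⟨(Matrix.of y).transpose, ?_⟩
  ext i j
  have := congrFun (hy j) i
  simp only [Matrix.mulVecLin_apply, Matrix.mulVec_single_one, Matrix.col_apply] at this
  rw [← this]
  rfl

theorem injective_mulVecLin_iff {ι κ : Type*} [Fintype ι] [DecidableEq ι] [Fintype κ]
    [DecidableEq κ]
    {v : Matrix ι κ k} : Function.Injective v.mulVecLin ↔ ∃ L : Matrix κ ι k, L * v = 1 := by
  constructor
  · intro h
    obtain ⟨g, hg⟩ := LinearMap.exists_leftInverse_of_injective _ (LinearMap.ker_eq_bot.2 h)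
    refine ⟨LinearMap.toMatrix' g, ?_⟩
    have := congrArg LinearMap.toMatrix' hg
    rwa [LinearMap.toMatrix'_comp, LinearMap.toMatrix'_id, ← Matrix.toLin'_apply',
      LinearMap.toMatrix'_toLin'] at this
  · rintro ⟨L, hL⟩ x y hxy
    have := congrArg L.mulVec hxy
    simpa [Matrix.mulVec_mulVec, hL] using this

theorem rank_mul_of_leftInverse {ι κ μ : Type*} [Fintype ι] [DecidableEq ι] [Fintype κ]
    [DecidableEq κ] [Fintype μ] {v : Matrix ι κ k} (h : ∃ L : Matrix κ ι k, L * v = 1)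
    (P : Matrix κ μ k) : (v * P).rank = P.rank := by
  obtain ⟨L, hL⟩ := h
  refine le_antisymm (Matrix.rank_mul_le_right _ _) ?_
  have := Matrix.rank_mul_le_right L (v * P)
  rwa [← Matrix.mul_assoc, hL, Matrix.one_mul] at this

theorem rank_mul_of_rightInverse {ι κ μ : Type*} [Fintype ι] [DecidableEq ι] [Fintype κ]
    [DecidableEq κ] [Fintype μ] {v : Matrix κ ι k} (h : ∃ L : Matrix ι κ k, v * L = 1)
    (P : Matrix μ κ k) : (P * v).rank = P.rank := by
  obtain ⟨L, hL⟩ := h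
  refine le_antisymm (Matrix.rank_mul_le_left _ _) ?_
  have := Matrix.rank_mul_le_left (P * v) L
  rwa [Matrix.mul_assoc, hL, Matrix.mul_one] at this

theorem mul_left_cancel_of_leftInverse {ι κ μ : Type*} [Fintype ι] [Fintype κ]
    [DecidableEq κ] {v : Matrix ι κ k} (h : ∃ L : Matrix κ ι k, L * v = 1)
    {P Q : Matrix κ μ k} (hPQ : v * P = v * Q) : P = Q := by
  obtain ⟨L, hL⟩ := h
  rw [← Matrix.one_mul P, ← hL, Matrix.mul_assoc, hPQ, ← Matrix.mul_assoc, hL, Matrix.one_mul]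

theorem mul_right_cancel_of_rightInverse {ι κ μ : Type*} [Fintype ι] [Fintype κ]
    [DecidableEq κ] {v : Matrix κ ι k} (h : ∃ L : Matrix ι κ k, v * L = 1)
    {P Q : Matrix μ κ k} (hPQ : P * v = Q * v) : P = Q := by
  obtain ⟨L, hL⟩ := h
  rw [← Matrix.mul_one P, ← hL, ← Matrix.mul_assoc, hPQ, Matrix.mul_assoc, hL, Matrix.mul_one]

theorem exists_leftInverse_iff_rank {ι κ : Type*} [Fintype ι] [DecidableEq ι] [Fintype κ]
    [DecidableEq κ] {v : Matrix ι κ k} :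
    (∃ L : Matrix κ ι k, L * v = 1) ↔ v.rank = Fintype.card κ := by
  rw [← injective_mulVecLin_iff]
  have := LinearMap.finrank_range_add_finrank_ker v.mulVecLin
  rw [Module.finrank_fintype_fun_eq_card] at this
  rw [← LinearMap.ker_eq_bot, ← Submodule.finrank_eq_zero (R := k), Matrix.rank]
  omega

theorem range_eq_top_iff_rank {ι κ : Type*} [Fintype ι] [DecidableEq ι] [Fintype κ]
    {v : Matrix ι κ k} : LinearMap.range v.mulVecLin = ⊤ ↔ v.rank = Fintype.card ι := by
  rw [Matrix.rank]
  constructor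
  · intro h
    rw [h, finrank_top, Module.finrank_fintype_fun_eq_card]
  · intro h
    exact Submodule.eq_top_of_finrank_eq (h.trans (Module.finrank_fintype_fun_eq_card k).symm)

theorem range_mul_of_range_eq_top {ι κ μ : Type*} [Fintype κ] [Fintype μ]
    (B : Matrix ι κ k) {P : Matrix κ μ k} (h : LinearMap.range P.mulVecLin = ⊤) :
    LinearMap.range (B * P).mulVecLin = LinearMap.range B.mulVecLin := by
  rw [Matrix.mulVecLin_mul]
  exact LinearMap.range_comp_of_range_eq_top _ h

/-- The number of bases of a space of dimension `d` does not depend on the ambient space. -/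
theorem card_bases [Finite k] {d : ℕ} {ι : Type*} [Fintype ι] [DecidableEq ι]
    (T : Submodule k (ι → k)) (hT : Module.finrank k T = d) :
    Nat.card {v : Matrix ι (Fin d) k // (∃ L : Matrix (Fin d) ι k, L * v = 1) ∧
      LinearMap.range v.mulVecLin = T} = Nat.card ((Fin d → k) ≃ₗ[k] (Fin d → k)) := by
  let e0 : T ≃ₗ[k] (Fin d → k) := LinearEquiv.ofFinrankEq _ _ (by simp [hT])
  let E1 : ((Fin d → k) ≃ₗ[k] T) ≃ ((Fin d → k) ≃ₗ[k] (Fin d → k)) :=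
    { toFun := fun e => e.trans e0
      invFun := fun e => e.trans e0.symm
      left_inv := fun e => by ext; simp
      right_inv := fun e => by ext; simp }
  rw [← Nat.card_congr E1]
  have hmat : ∀ e : (Fin d → k) ≃ₗ[k] T,
      (LinearMap.toMatrix' (T.subtype.comp e.toLinearMap)).mulVecLin =
        T.subtype.comp e.toLinearMap := fun e => by
    rw [← Matrix.toLin'_apply', Matrix.toLin'_toMatrix']
  refine (Nat.card_congr (Equiv.ofBijective (fun e : (Fin d → k) ≃ₗ[k] T =>
    (⟨LinearMap.toMatrix' (T.subtype.comp e.toLinearMap), ?_, ?_⟩ : {v : Matrix ι (Fin d) k //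
      (∃ L : Matrix (Fin d) ι k, L * v = 1) ∧ LinearMap.range v.mulVecLin = T})) ⟨?_, ?_⟩)).symm
  · rw [← injective_mulVecLin_iff, hmat]
    exact T.injective_subtype.comp e.injective
  · rw [hmat, LinearMap.range_comp_of_range_eq_top _ (LinearEquiv.range e), Submodule.range_subtype]
  · intro e e' h
    have h1 := LinearMap.toMatrix'.injective (congrArg Subtype.val h)
    ext x : 1
    exact T.injective_subtype (LinearMap.congr_fun h1 x)
  · rintro ⟨v, hv, rfl⟩
    refine ⟨LinearEquiv.ofInjective v.mulVecLin (injective_mulVecLin_iff.2 hv), ?_⟩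
    ext1
    apply Matrix.toLin'.injective
    rw [Matrix.toLin'_toMatrix', Matrix.toLin'_apply']
    ext
    simp

theorem card_linearEquiv_ne_zero [Finite k] (d : ℕ) :
    (Nat.card ((Fin d → k) ≃ₗ[k] (Fin d → k)) : ℂ) ≠ 0 := by
  have : Finite ((Fin d → k) ≃ₗ[k] (Fin d → k)) := DFunLike.finite _
  exact Nat.cast_ne_zero.2 (Nat.card_pos (α := _)).ne'

end LeftInverse

/-! ### Counting injective matrices with given Gram matrix -/

section InjectiveGram

variable {k : Type*} [Field k] [StarRing k] {q : ℕ}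

/-- Double counting of rank factorisations `v = u * P`. The columns of `u` may be any basis of the
column space of `v`, and `u` then determines both `P` and its own Gram matrix `H'`. -/
theorem card_gram_rank_mul [Finite k] {m d : ℕ} (r : ℕ) (H : Matrix (Fin d) (Fin d) k) :
    Nat.card {v : {v : Matrix (Fin m) (Fin d) k // v.conjTranspose * v = H} // v.1.rank = r} *
        Nat.card ((Fin r → k) ≃ₗ[k] (Fin r → k)) =
      Nat.card (Σ H' : Matrix (Fin r) (Fin r) k,
        {u : Matrix (Fin m) (Fin r) k // (∃ L : Matrix (Fin r) (Fin m) k, L * u = 1) ∧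
          u.conjTranspose * u = H'} ×
        {P : Matrix (Fin r) (Fin d) k // P.rank = r ∧ P.conjTranspose * H' * P = H}) := by
  symm
  have hrange : ∀ P : Matrix (Fin r) (Fin d) k, P.rank = r → LinearMap.range P.mulVecLin = ⊤ :=
    fun P hP => range_eq_top_iff_rank.2 (by rw [hP, Fintype.card_fin])
  refine card_eq_mul_of_card_fiber (fun x => ⟨⟨x.2.1.1 * x.2.2.1, ?_⟩, ?_⟩) _ ?_
  rotate_left
  · rw [Matrix.conjTranspose_mul, Matrix.mul_assoc, ← Matrix.mul_assoc _ _ x.2.2.1, x.2.1.2.2,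
      ← Matrix.mul_assoc, x.2.2.2.2]
  · exact (rank_mul_of_leftInverse x.2.1.2.1 _).trans x.2.2.2.1
  · rintro ⟨⟨v, hv⟩, hr⟩
    rw [← card_bases (LinearMap.range v.mulVecLin) hr]
    refine Nat.card_congr (Equiv.ofBijective (fun x => ⟨x.1.2.1.1, x.1.2.1.2.1, ?_⟩) ⟨?_, ?_⟩)
    · obtain ⟨⟨H', ⟨u, hu⟩, ⟨P, hP⟩⟩, hx⟩ := x
      have hx' : u * P = v := congrArg (fun z => z.1.1) hx
      exact (range_mul_of_range_eq_top u (hrange P hP.1)).symm.trans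
        (congrArg (fun w : Matrix (Fin m) (Fin d) k => LinearMap.range w.mulVecLin) hx')
    · rintro ⟨⟨H', ⟨u, hu⟩, ⟨P, hP⟩⟩, hx⟩ ⟨⟨H₁, ⟨u₁, hu₁⟩, ⟨P₁, hP₁⟩⟩, hx₁⟩ h
      have h' : u = u₁ := congrArg Subtype.val h
      subst h'
      have hx' : u * P = v := congrArg (fun z => z.1.1) hx
      have hx₁' : u * P₁ = v := congrArg (fun z => z.1.1) hx₁
      obtain rfl : P = P₁ := mul_left_cancel_of_leftInverse hu.1 (hx'.trans hx₁'.symm)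
      obtain rfl : H' = H₁ := hu.2.symm.trans hu₁.2
      rfl
    · rintro ⟨u, hu, hru⟩
      have hle : ∃ P : Matrix (Fin r) (Fin d) k, v = u * P :=
        exists_eq_mul_of_range_le (A := v) (B := u) (le_of_eq hru.symm)
      have hle2 : ∃ P : Matrix (Fin r) (Fin d) k, v = u * P ∧ P.rank = r ∧
          P.conjTranspose * (u.conjTranspose * u) * P = H := by
        obtain ⟨P, hP⟩ := hle
        refine ⟨P, hP, ?_, ?_⟩
        · rw [← rank_mul_of_leftInverse hu P, ← hP]
          exact hr
        · rw [← hv, hP, Matrix.conjTranspose_mul]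
          simp only [Matrix.mul_assoc]
      exact Exists.elim hle2 fun P hP => ⟨⟨⟨u.conjTranspose * u, ⟨u, hu, rfl⟩, ⟨P, hP.2⟩⟩,
        Subtype.ext (Subtype.ext hP.1.symm)⟩, rfl⟩

/-- The number of injective `m × d` matrices with given Gram matrix is a polynomial in
`(-q) ^ m`. -/
theorem isPolyInPow_card_injective_gram [Fintype k] (hk : Fintype.card k = q ^ 2)
    (hs : ∀ x : k, star x = x ^ q) (d : ℕ) :
    ∀ H : Matrix (Fin d) (Fin d) k, IsPolyInPow q fun m =>
      (Nat.card {v : Matrix (Fin m) (Fin d) k // (∃ L : Matrix (Fin d) (Fin m) k, L * v = 1) ∧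
        v.conjTranspose * v = H} : ℂ) := by
  classical
  induction d using Nat.strong_induction_on with
  | _ d ih =>
  intro H
  -- Remove the matrices of rank `r < d`. Via their rank factorisations they are counted by
  -- injective matrices with `r` columns, to which induction applies.
  have h1 := (isPolyInPow_card_gram hk hs H).sub (IsPolyInPow.sum (Finset.range d)
    (F := fun r m => (Nat.card ((Fin r → k) ≃ₗ[k] (Fin r → k)) : ℂ)⁻¹ *
      ∑ H' : Matrix (Fin r) (Fin r) k, (Nat.card {P : Matrix (Fin r) (Fin d) k //
        P.rank = r ∧ P.conjTranspose * H' * P = H} : ℂ) *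
      (Nat.card {u : Matrix (Fin m) (Fin r) k // (∃ L : Matrix (Fin r) (Fin m) k, L * u = 1) ∧
          u.conjTranspose * u = H'} : ℂ))
    (fun r hr => IsPolyInPow.const_mul (IsPolyInPow.sum _ fun H' _ =>
      (ih r (Finset.mem_range.1 hr) H').const_mul _) _))
  refine h1.congr fun m => ?_
  have h2 := card_eq_sum_card_fiber
    (fun v : {v : Matrix (Fin m) (Fin d) k // v.conjTranspose * v = H} => v.1.rank) (d + 1)
    (fun v => Nat.lt_succ_of_le (by simpa using v.1.rank_le_width))
  rw [Finset.sum_range_succ] at h2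
  have h3 : Nat.card {v : {v : Matrix (Fin m) (Fin d) k // v.conjTranspose * v = H} //
      v.1.rank = d} = Nat.card {v : Matrix (Fin m) (Fin d) k //
        (∃ L : Matrix (Fin d) (Fin m) k, L * v = 1) ∧ v.conjTranspose * v = H} := by
    refine Nat.card_congr ((Equiv.subtypeSubtypeEquivSubtypeInter _
      (fun v : Matrix (Fin m) (Fin d) k => v.rank = d)).trans (Equiv.subtypeEquivRight fun v => ?_))
    rw [exists_leftInverse_iff_rank, Fintype.card_fin, and_comm]
  rw [h3] at h2
  have h4 : ∀ r : ℕ, (Nat.card {v : {v : Matrix (Fin m) (Fin d) k // v.conjTranspose * v = H} //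
      v.1.rank = r} : ℂ) = (Nat.card ((Fin r → k) ≃ₗ[k] (Fin r → k)) : ℂ)⁻¹ *
      ∑ H' : Matrix (Fin r) (Fin r) k, (Nat.card {P : Matrix (Fin r) (Fin d) k //
        P.rank = r ∧ P.conjTranspose * H' * P = H} : ℂ) *
      (Nat.card {u : Matrix (Fin m) (Fin r) k // (∃ L : Matrix (Fin r) (Fin m) k, L * u = 1) ∧
          u.conjTranspose * u = H'} : ℂ) := by
    intro r
    rw [eq_inv_mul_iff_mul_eq₀ (card_linearEquiv_ne_zero r), mul_comm]
    have := card_gram_rank_mul (m := m) r H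
    rw [Nat.card_sigma] at this
    simp only [Nat.card_prod] at this
    exact_mod_cast this.trans (Finset.sum_congr rfl fun _ _ => mul_comm _ _)
  rw [h2, Nat.cast_add, Nat.cast_sum, eq_sub_iff_add_eq, add_comm]
  congr 1
  exact Finset.sum_congr rfl fun r _ => (h4 r).symm

end InjectiveGram
-- Torsion in cyclic modules over `k[t]`
section Torsion

variable {k : Type*} [Field k]

theorem natCard_quotient_span [Finite k] {h : k[X]} (hh : h ≠ 0) :
    Nat.card (k[X] ⧸ Ideal.span {h}) = Nat.card k ^ h.natDegree := by
  have : Module.Finite k (k[X] ⧸ Ideal.span {h}) :=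
    (AdjoinRoot.powerBasis hh).finite
  rw [Module.natCard_eq_pow_finrank (K := k), finrank_quotient_span_eq_natDegree]

theorem finite_quotient_span [Finite k] {h : k[X]} (hh : h ≠ 0) :
    Finite (k[X] ⧸ Ideal.span {h}) := by
  have : Module.Finite k (k[X] ⧸ Ideal.span {h}) :=
    (AdjoinRoot.powerBasis hh).finite
  exact Module.finite_of_finite k

/-- On a finite module the kernel and cokernel of multiplication by `f` have the same size, and the
cokernel is `k[X] / (g, f) = k[X] / (h)`. -/
theorem natCard_torsionBy_quotient [Finite k] {f g h : k[X]} (hg : g ≠ 0)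
    (hspan : Ideal.span {g} ⊔ Ideal.span {f} = Ideal.span {h}) :
    Nat.card {x : k[X] ⧸ Ideal.span {g} // f • x = 0} = Nat.card k ^ h.natDegree := by
  have hh : h ≠ 0 := by
    rintro rfl
    apply hg
    have : g ∈ Ideal.span {g} ⊔ Ideal.span {f} :=
      Ideal.mem_sup_left (Ideal.mem_span_singleton_self g)
    rw [hspan] at this
    simpa using this
  let Q := k[X] ⧸ Ideal.span {g}
  have hfin : Finite Q := finite_quotient_span hg
  let a : Q := Ideal.Quotient.mk _ f
  let l : Q →ₗ[Q] Q := LinearMap.mulLeft Q a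
  have h1 := Submodule.card_eq_card_quotient_mul_card (LinearMap.ker l)
  have h2 := Submodule.card_eq_card_quotient_mul_card (LinearMap.range l)
  have h3 : Nat.card (Q ⧸ LinearMap.ker l) = Nat.card (LinearMap.range l) :=
    Nat.card_congr l.quotKerEquivRange.toEquiv
  have h4 : LinearMap.range l = (Ideal.span {f}).map (Ideal.Quotient.mk (Ideal.span {g})) := by
    rw [Ideal.map_span, Set.image_singleton]
    ext y
    rw [Ideal.mem_span_singleton']
    simp only [LinearMap.mem_range, l, LinearMap.mulLeft_apply]
    exact exists_congr fun z => by rw [mul_comm]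
  have h5 : Nat.card (Q ⧸ LinearMap.range l) = Nat.card k ^ h.natDegree := by
    rw [← natCard_quotient_span hh, h4]
    exact Nat.card_congr ((DoubleQuot.quotQuotEquivQuotSup (Ideal.span {g}) (Ideal.span {f})).trans
      (Ideal.quotEquivOfEq hspan)).toEquiv
  have h6 : Nat.card {x : k[X] ⧸ Ideal.span {g} // f • x = 0} = Nat.card (LinearMap.ker l) := by
    refine Nat.card_congr (Equiv.subtypeEquivRight fun x => ?_)
    have hx : f • x = a * x := by
      obtain ⟨y, rfl⟩ := Ideal.Quotient.mk_surjective x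
      rfl
    rw [LinearMap.mem_ker, LinearMap.mulLeft_apply, hx]
  rw [h6, ← h5]
  rw [h1, h3] at h2
  have h7 : 0 < Nat.card (LinearMap.range l) := Nat.card_pos
  exact Nat.eq_of_mul_eq_mul_left h7 (by rw [← h2, mul_comm])

theorem span_sup_span_pow {f f' r : k[X]} {e i : ℕ} (hf : f = r ^ e * f') (hc : IsCoprime f' r) :
    Ideal.span {r ^ i} ⊔ Ideal.span {f} = Ideal.span {r ^ min i e} := by
  rw [hf]
  apply le_antisymm
  · rw [sup_le_iff, Ideal.span_singleton_le_span_singleton, Ideal.span_singleton_le_span_singleton]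
    exact ⟨pow_dvd_pow r (min_le_left _ _), (pow_dvd_pow r (min_le_right _ _)).mul_right _⟩
  · rw [Ideal.span_singleton_le_iff_mem, Ideal.mem_span_singleton_sup]
    rcases le_total i e with h | h
    · rw [min_eq_left h]
      exact ⟨1, 0, zero_mem _, by simp⟩
    · rw [min_eq_right h]
      obtain ⟨a, b, hab⟩ := hc.pow_right (n := i - e)
      refine ⟨b, a * (r ^ e * f'), Ideal.mul_mem_left _ _ (Ideal.mem_span_singleton_self _), ?_⟩
      obtain ⟨t, rfl⟩ := Nat.exists_eq_add_of_le h
      rw [Nat.add_sub_cancel_left] at hab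
      rw [pow_add]
      linear_combination (r ^ e) * hab

theorem natCard_torsionBy_primePower [Finite k] {f f' : k[X]} {r : k[X]} (hr : r ≠ 0) {e i : ℕ}
    (hf : f = r ^ e * f') (hc : IsCoprime f' r) :
    Nat.card {x : k[X] ⧸ Ideal.span {r ^ i} // f • x = 0} =
      Nat.card k ^ (r.natDegree * min i e) := by
  rw [natCard_torsionBy_quotient (pow_ne_zero i hr) (span_sup_span_pow hf hc), natDegree_pow,
    mul_comm]

end Torsion

/-! ### Torsion in modules of given type -/

section TypeIndex

variable {k : Type*} [Field k]

/-- The index set of the elementary divisors of a module of type `μ`. -/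
abbrev TypeIndex (μ : Multipartition k) : Type _ :=
  Σ r : MonicIrred k, Σ i : ℕ+, Fin ((μ r).count i)

/-- The elementary divisors at the finitely many `r` with `μ(r)` nonempty. -/
def typeIndexEquiv (μ : Multipartition k) :
    TypeIndex μ ≃ Σ r : μ.support, (μ r.1).ToType where
  toFun j := ⟨⟨j.1, by
    rw [Finsupp.mem_support_iff]
    intro h
    have := j.2.2.2
    simp [h] at this⟩, j.2⟩
  invFun j := ⟨j.1.1, j.2⟩
  left_inv _ := rfl
  right_inv _ := rfl

instance (μ : Multipartition k) : Finite (TypeIndex μ) :=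
  Finite.of_equiv _ (typeIndexEquiv μ).symm

theorem sum_typeIndex (μ : Multipartition k) [Fintype (TypeIndex μ)]
    (w : MonicIrred k → ℕ+ → ℕ) :
    ∑ j : TypeIndex μ, w j.1 j.2.1 = μ.sum fun r s => (s.map (w r)).sum := by
  rw [Fintype.sum_equiv (typeIndexEquiv μ) (fun j : TypeIndex μ => w j.1 j.2.1)
    (fun j => w j.1.1 j.2.1) (fun _ => rfl), Fintype.sum_sigma, Finsupp.sum,
    ← Finset.sum_coe_sort μ.support fun r => ((μ r).map (w r)).sum]
  refine Fintype.sum_congr _ _ fun r => ?_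
  exact congrArg Multiset.sum (Multiset.map_univ (μ r.1) (w r.1))

/-- The torsion of a direct sum of cyclic modules. -/
theorem natCard_torsionBy_of_type [Finite k] {M : Type*} [AddCommGroup M] [Module k[X] M]
    {μ : Multipartition k}
    (e : M ≃ₗ[k[X]] ⨁ j : TypeIndex μ, k[X] ⧸ Ideal.span {(j.1.1 : k[X]) ^ (j.2.1 : ℕ)})
    (f : k[X]) (w : MonicIrred k → ℕ+ → ℕ)
    (hw : ∀ (r : MonicIrred k) (i : ℕ+),
      Nat.card {x : k[X] ⧸ Ideal.span {(r.1 : k[X]) ^ (i : ℕ)} // f • x = 0} =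
      Nat.card k ^ w r i) :
    Nat.card {x : M // f • x = 0} = Nat.card k ^ (μ.sum fun r s => (s.map (w r)).sum) := by
  classical
  have := Fintype.ofFinite (TypeIndex μ)
  let E := e.trans (DirectSum.linearEquivFunOnFintype k[X] (TypeIndex μ)
    fun j => k[X] ⧸ Ideal.span {(j.1.1 : k[X]) ^ (j.2.1 : ℕ)})
  have h1 : Nat.card {x : M // f • x = 0} =
      Nat.card {x : ∀ j : TypeIndex μ, k[X] ⧸ Ideal.span {(j.1.1 : k[X]) ^ (j.2.1 : ℕ)} //
        ∀ j, f • x j = 0} := by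
    refine Nat.card_congr (E.toEquiv.subtypeEquiv fun x => ?_)
    change _ ↔ ∀ j, (f • E x) j =
      (0 : ∀ j : TypeIndex μ, k[X] ⧸ Ideal.span {(j.1.1 : k[X]) ^ (j.2.1 : ℕ)}) j
    rw [← funext_iff, ← map_smul, map_eq_zero_iff E E.injective]
  rw [h1, Nat.card_congr (Equiv.subtypePiEquivPi (p := fun j x => f • x = 0)), Nat.card_pi,
    ← sum_typeIndex, ← Finset.prod_pow_eq_pow_sum]
  exact Finset.prod_congr rfl fun j _ => hw _ _

end TypeIndex

/-! ### Partitions and their columns -/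

section Multisets

theorem sum_map_min_succ (s : Multiset ℕ+) (j : ℕ) :
    (s.map fun i : ℕ+ => min (i : ℕ) (j + 1)).sum =
      (s.map fun i : ℕ+ => min (i : ℕ) j).sum + s.countP fun i : ℕ+ => j < (i : ℕ) := by
  induction s using Multiset.induction_on with
  | empty => simp
  | cons a s ih =>
    rw [Multiset.map_cons, Multiset.sum_cons, Multiset.map_cons, Multiset.sum_cons, ih,
      Multiset.countP_cons]
    split_ifs with h <;> omega

theorem countP_lt_eq (s : Multiset ℕ+) (a : ℕ+) :
    (s.countP fun i : ℕ+ => (a : ℕ) - 1 < (i : ℕ)) =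
      (s.countP fun i : ℕ+ => (a : ℕ) < (i : ℕ)) + s.count a := by
  induction s using Multiset.induction_on with
  | empty => simp
  | cons b s ih =>
    rw [Multiset.countP_cons, Multiset.countP_cons, Multiset.count_cons, ih]
    have ha := a.pos
    have : a = b ↔ (a : ℕ) = b := PNat.coe_inj.symm
    simp only [this]
    split_ifs <;> omega

/-- First differences in `j` are the column lengths; differences of column lengths are the
multiplicities of the parts. -/
theorem multiset_ext_of_sum_min {s t : Multiset ℕ+}
    (h : ∀ j : ℕ,
      (s.map fun i : ℕ+ => min (i : ℕ) j).sum = (t.map fun i : ℕ+ => min (i : ℕ) j).sum) :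
    s = t := by
  have h1 : ∀ j : ℕ, (s.countP fun i : ℕ+ => j < (i : ℕ)) = t.countP fun i : ℕ+ => j < (i : ℕ) := by
    intro j
    have := h (j + 1)
    rw [sum_map_min_succ, sum_map_min_succ, h j] at this
    omega
  ext a
  have h2 := countP_lt_eq s a
  have h3 := countP_lt_eq t a
  rw [h1, h1] at h2
  omega

theorem sum_map_removeFirstColumn (s : Partition) (f : ℕ → ℕ) (hf : f 0 = 0) :
    ((removeFirstColumn s).map fun i : ℕ+ => f i).sum =
      (s.map fun i : ℕ+ => f ((i : ℕ) - 1)).sum := by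
  induction s using Multiset.induction_on with
  | empty => simp [removeFirstColumn]
  | cons a s ih =>
    rw [Multiset.map_cons, Multiset.sum_cons, ← ih]
    unfold removeFirstColumn
    by_cases h : 1 < a
    · rw [Multiset.filterMap_cons_some _ _ _ (b := a - 1) (by simp [h]), Multiset.map_cons,
        Multiset.sum_cons, PNat.sub_coe, if_pos h]
      rfl
    · rw [Multiset.filterMap_cons_none _ _ (by simp [h])]
      have : a = 1 := le_antisymm (not_lt.1 h) (one_le)
      simp [this, hf]

/-- A partition is determined by its first column and the rest. -/
theorem eq_of_removeFirstColumn_eq {s t : Partition}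
    (h : removeFirstColumn s = removeFirstColumn t) (hc : s.card = t.card) : s = t := by
  apply multiset_ext_of_sum_min
  have hcard : ∀ u : Partition, u.card = (u.map fun _ => 1).sum := fun u => by simp
  have h1 : ∀ (u : Partition) (j : ℕ), (u.map fun i : ℕ+ => min (i : ℕ) (j + 1)).sum =
      u.card + ((removeFirstColumn u).map fun i : ℕ+ => min (i : ℕ) j).sum := by
    intro u j
    rw [sum_map_removeFirstColumn u (fun i => min i j) (by simp), hcard u,
      ← Multiset.sum_map_add]
    congr 1
    refine Multiset.map_congr rfl fun i _ => ?_
    have := i.pos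
    omega
  intro j
  cases j with
  | zero => simp
  | succ j => rw [h1, h1, h, hc]

end Multisets
-- Existence of types
section ExistsType

/-- Discarding trivial factors of a finite product and replacing the others by isomorphic ones. -/
theorem nonempty_pi_linearEquiv {R ι κ : Type*} [CommRing R] [Fintype κ] {Q : ι → Type*}
    {Q' : κ → Type*} [∀ i, AddCommGroup (Q i)] [∀ i, Module R (Q i)] [∀ j, AddCommGroup (Q' j)]
    [∀ j, Module R (Q' j)] (σ : κ → ι) (hσ : Function.Injective σ)
    (hQ : ∀ i, i ∉ Set.range σ → Subsingleton (Q i)) (e : ∀ j, Q' j ≃ₗ[R] Q (σ j)) :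
    Nonempty ((∀ i, Q i) ≃ₗ[R] ∀ j, Q' j) := by
  classical
  let F : (∀ i, Q i) →ₗ[R] ∀ j, Q' j :=
    LinearMap.pi fun j => (e j).symm.toLinearMap.comp (LinearMap.proj (σ j))
  refine ⟨LinearEquiv.ofBijective F ⟨?_, ?_⟩⟩
  · rw [injective_iff_map_eq_zero]
    intro x hx
    funext i
    by_cases hi : i ∈ Set.range σ
    · obtain ⟨j, rfl⟩ := hi
      have := congrFun hx j
      simpa [F] using this
    · exact (hQ i hi).elim _ _
  · intro y
    refine ⟨∑ j, Pi.single (σ j) (e j (y j)), ?_⟩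
    funext j
    simp only [F, LinearMap.pi_apply, LinearMap.comp_apply, LinearMap.proj_apply, Finset.sum_apply]
    rw [Finset.sum_eq_single j]
    · simp
    · intro b _ hb
      exact Pi.single_eq_of_ne (fun h => hb (hσ h).symm) _
    · simp

variable {k : Type*} [Field k]

/-- Collects a finite family of elementary divisors, with repetitions, into a multipartition. -/
theorem exists_typeIndex_equiv {J : Type*} [Finite J] (φ : J → MonicIrred k × ℕ+) :
    ∃ (μ : Multipartition k) (E : TypeIndex μ ≃ J), ∀ j, φ (E j) = (j.1, j.2.1) := by
  classical
  have := Fintype.ofFinite J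
  let μ : Multipartition k := ∑ j, Finsupp.single (φ j).1 {(φ j).2}
  have hcount : ∀ (r : MonicIrred k) (i : ℕ+),
      (μ r).count i = Fintype.card {x // φ x = (r, i)} := by
    intro r i
    rw [Fintype.card_subtype, Finset.card_filter, Finsupp.finsetSum_apply, Multiset.count_sum']
    refine Finset.sum_congr rfl fun j _ => ?_
    rw [Finsupp.single_apply]
    by_cases h1 : (φ j).1 = r <;> by_cases h2 : i = (φ j).2 <;>
      simp [Prod.ext_iff, h1, h2, eq_comm]
  let E1 : TypeIndex μ ≃ Σ r : MonicIrred k, Σ i : ℕ+, {x // φ x = (r, i)} :=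
    Equiv.sigmaCongrRight fun r => Equiv.sigmaCongrRight fun i =>
      (finCongr (hcount r i)).trans (Fintype.equivFin _).symm
  let E2 : (Σ r : MonicIrred k, Σ i : ℕ+, {x // φ x = (r, i)}) ≃ J :=
    { toFun := fun j => j.2.2.1
      invFun := fun x => ⟨(φ x).1, (φ x).2, x, rfl⟩
      left_inv := by
        rintro ⟨r, i, x, hx⟩
        obtain ⟨rfl, rfl⟩ := Prod.ext_iff.1 hx
        rfl
      right_inv := fun _ => rfl }
  exact ⟨μ, E1.trans E2, fun j => (E1 j).2.2.2⟩

/-- A finitely generated torsion module over `k[t]` on which `t` acts injectively has a type. -/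
theorem exists_type {M : Type*} [AddCommGroup M] [Module k[X] M] [Module.Finite k[X] M]
    (hM : Module.IsTorsion k[X] M) (hX : ∀ x : M, (X : k[X]) • x = 0 → x = 0) :
    ∃ μ : Multipartition k, Nonempty (M ≃ₗ[k[X]]
      ⨁ j : TypeIndex μ, k[X] ⧸ Ideal.span {(j.1.1 : k[X]) ^ (j.2.1 : ℕ)}) := by
  classical
  obtain ⟨ι, _, p, hp, e, ⟨T⟩⟩ := Module.equiv_directSum_of_isTorsion hM
  -- The structure theorem may produce trivial factors with exponent `0`; these are discarded.
  let J := {i : ι // e i ≠ 0}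
  have hne : ∀ i : J, normalize (p i) ≠ X := by
    rintro ⟨i, hi⟩ h
    have hXp : Associated (p i) X := by
      have := normalize_associated (p i)
      rw [show normalize (p i) = X from h] at this
      exact this.symm
    -- If `p i` were associated to `X`, this nonzero class would be killed by `X`, contradicting
    -- injectivity of `t`.
    let y : k[X] ⧸ k[X] ∙ p i ^ e i := Submodule.Quotient.mk (p i ^ (e i - 1))
    have hy : (X : k[X]) • y = 0 := by
      rw [← Submodule.Quotient.mk_smul, Submodule.Quotient.mk_eq_zero, smul_eq_mul]
      refine Ideal.mem_span_singleton.2 ?_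
      refine dvd_trans (dvd_of_eq ?_) (mul_dvd_mul_right hXp.dvd _)
      rw [← pow_succ', Nat.sub_add_cancel (Nat.one_le_iff_ne_zero.2 hi)]
    have hy0 : y ≠ 0 := by
      intro h0
      rw [Submodule.Quotient.mk_eq_zero] at h0
      have := Ideal.mem_span_singleton.1 h0
      rw [pow_dvd_pow_iff (hp i).ne_zero (hp i).not_isUnit] at this
      omega
    have h1 := hX (T.symm (DirectSum.lof k[X] ι (fun i => k[X] ⧸ k[X] ∙ p i ^ e i) i y)) (by
      rw [← map_smul, ← map_smul, hy, map_zero, map_zero])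
    rw [LinearEquiv.map_eq_zero_iff] at h1
    apply hy0
    have h2 := congrArg (fun z => DirectSum.component k[X] ι _ i z) h1
    simpa [DirectSum.component.lof_self] using h2
  let φ : J → MonicIrred k × ℕ+ := fun i =>
    (⟨normalize (p i), monic_normalize (hp i).ne_zero,
      (normalize_associated (p i)).symm.irreducible (hp i), hne i⟩, ⟨e i, Nat.pos_of_ne_zero i.2⟩)
  obtain ⟨μ, E, hE⟩ := exists_typeIndex_equiv φ
  have := Fintype.ofFinite (TypeIndex μ)
  have hspan : ∀ j : TypeIndex μ, Ideal.span {(j.1.1 : k[X]) ^ (j.2.1 : ℕ)} =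
      Ideal.span {p (E j) ^ e (E j)} := by
    intro j
    have h1 : (φ (E j)).1.1 = j.1.1 := by rw [hE]
    have h2 : ((φ (E j)).2 : ℕ) = j.2.1 := by rw [hE]
    rw [← h1, ← h2]
    exact Ideal.span_singleton_eq_span_singleton.2 ((normalize_associated (p (E j))).pow_pow)
  obtain ⟨L⟩ := nonempty_pi_linearEquiv (R := k[X]) (Q := fun i => k[X] ⧸ k[X] ∙ p i ^ e i)
    (Q' := fun j : TypeIndex μ => k[X] ⧸ Ideal.span {(j.1.1 : k[X]) ^ (j.2.1 : ℕ)})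
    (fun j => (E j : ι)) (Subtype.val_injective.comp E.injective) (by
      intro i hi
      have he : e i = 0 := by
        by_contra h
        exact hi ⟨E.symm ⟨i, h⟩, by simp⟩
      rw [Submodule.Quotient.subsingleton_iff, he, pow_zero]
      exact Ideal.span_singleton_one)
    (fun j => Submodule.quotEquivOfEq _ _ (hspan j))
  exact ⟨μ, ⟨(T.trans (DirectSum.linearEquivFunOnFintype k[X] ι _)).trans
    (L.trans (DirectSum.linearEquivFunOnFintype k[X] (TypeIndex μ) _).symm)⟩⟩

end ExistsType

/-! ### Types of matrices: existence, ranks and similarity -/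

section Matrices

variable {k : Type*} [Field k] {n : ℕ}

theorem smul_of_toLin' (A : Matrix (Fin n) (Fin n) k) (f : k[X]) (v : Fin n → k) :
    f • Module.AEval'.of (Matrix.toLin' A) v =
      Module.AEval'.of (Matrix.toLin' A) ((aeval A f).mulVec v) := by
  have h : aeval (Matrix.toLin' A) f = Matrix.toLin' (aeval A f) :=
    aeval_algHom_apply (Matrix.toLinAlgEquiv' : Matrix (Fin n) (Fin n) k ≃ₐ[k] _).toAlgHom A f
  rw [← Matrix.toLin'_apply, ← h]
  exact (Module.AEval.of_aeval_smul (Matrix.toLin' A) f v).symm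

theorem exists_hasType {A : Matrix (Fin n) (Fin n) k} (hA : IsUnit A) : ∃ μ, HasType A μ := by
  refine exists_type ?_ ?_
  · exact Module.AEval.isTorsion_of_finiteDimensional k (Fin n → k) (Matrix.toLin' A)
  · intro x hx
    obtain ⟨v, rfl⟩ := (Module.AEval'.of (Matrix.toLin' A)).surjective x
    rw [smul_of_toLin', aeval_X, LinearEquiv.map_eq_zero_iff] at hx
    rw [LinearEquiv.map_eq_zero_iff]
    exact Matrix.mulVec_injective_of_isUnit hA (hx.trans (Matrix.mulVec_zero A).symm)

theorem natCard_torsionBy_aeval [Finite k] (A : Matrix (Fin n) (Fin n) k) (f : k[X]) :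
    Nat.card {x : Module.AEval' (Matrix.toLin' A) // f • x = 0} =
      Nat.card k ^ (n - (aeval A f).rank) := by
  have h1 : Nat.card {x : Module.AEval' (Matrix.toLin' A) // f • x = 0} =
      Nat.card (LinearMap.ker (aeval A f).mulVecLin) := by
    refine (Nat.card_congr ((Module.AEval'.of (Matrix.toLin' A)).toEquiv.subtypeEquiv
      fun v => ?_)).symm
    change _ ↔ f • Module.AEval'.of (Matrix.toLin' A) v = 0
    rw [smul_of_toLin', LinearEquiv.map_eq_zero_iff, LinearMap.mem_ker, Matrix.mulVecLin_apply]
  have h2 := LinearMap.finrank_range_add_finrank_ker (aeval A f).mulVecLin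
  rw [Module.finrank_fin_fun] at h2
  rw [h1, Module.natCard_eq_pow_finrank (K := k), Matrix.rank]
  congr 1
  omega

/-- The ranks of polynomials in a matrix of given type. -/
theorem HasType.rank_aeval_add [Finite k] {A : Matrix (Fin n) (Fin n) k} {μ : Multipartition k}
    (h : HasType A μ) (f : k[X]) (w : MonicIrred k → ℕ+ → ℕ)
    (hw : ∀ (r : MonicIrred k) (i : ℕ+),
      Nat.card {x : k[X] ⧸ Ideal.span {(r.1 : k[X]) ^ (i : ℕ)} // f • x = 0} =
        Nat.card k ^ w r i) :
    (aeval A f).rank + (μ.sum fun r s => (s.map (w r)).sum) = n := by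
  obtain ⟨e⟩ := h
  have h1 := natCard_torsionBy_of_type e f w hw
  rw [natCard_torsionBy_aeval] at h1
  have h2 := Nat.pow_right_injective (Finite.one_lt_card (α := k)) h1
  have h3 := (aeval A f).rank_le_width
  omega

theorem isCoprime_of_ne {r s : MonicIrred k} (h : r ≠ s) : IsCoprime r.1 s.1 := by
  refine (r.2.2.1.coprime_iff_not_dvd).2 fun hd => h ?_
  exact Subtype.ext (eq_of_monic_of_associated r.2.1 s.2.1
    ((r.2.2.1.dvd_irreducible_iff_associated s.2.2.1).1 hd))

/-- The type of similar matrices. -/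
theorem HasType.exists_conj {A B : Matrix (Fin n) (Fin n) k} {μ : Multipartition k}
    (hA : HasType A μ) (hB : HasType B μ) : ∃ P : GL (Fin n) k,
      (P : Matrix (Fin n) (Fin n) k) * A = B * (P : Matrix (Fin n) (Fin n) k) := by
  obtain ⟨e⟩ := hA
  obtain ⟨e'⟩ := hB
  let ψ := e.trans e'.symm
  let L : (Fin n → k) ≃ₗ[k] (Fin n → k) :=
    { toFun := fun v => (Module.AEval'.of (Matrix.toLin' B)).symm
        (ψ (Module.AEval'.of (Matrix.toLin' A) v))
      invFun := fun v => (Module.AEval'.of (Matrix.toLin' A)).symm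
        (ψ.symm (Module.AEval'.of (Matrix.toLin' B) v))
      left_inv := fun v => by simp
      right_inv := fun v => by simp
      map_add' := fun v w => by simp
      map_smul' := fun c v => by
        rw [map_smul, ← Module.AEval.C_smul, map_smul, Module.AEval.C_smul, map_smul]
        rfl }
  have hL : ∀ v, L (A.mulVec v) = B.mulVec (L v) := by
    intro v
    apply (Module.AEval'.of (Matrix.toLin' B)).injective
    have h1 := smul_of_toLin' A X v
    have h2 := smul_of_toLin' B X (L v)
    rw [aeval_X] at h1 h2
    rw [← h2]
    simp only [L, LinearEquiv.coe_mk, LinearMap.coe_mk, AddHom.coe_mk, LinearEquiv.apply_symm_apply]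
    rw [← h1, map_smul]
  let P : GL (Fin n) k := ⟨LinearMap.toMatrix' L.toLinearMap,
    LinearMap.toMatrix' L.symm.toLinearMap,
    by rw [← LinearMap.toMatrix'_comp]; simp, by rw [← LinearMap.toMatrix'_comp]; simp⟩
  refine ⟨P, ?_⟩
  apply Matrix.toLin'.injective
  have hP : Matrix.toLin' (P : Matrix _ _ k) = L.toLinearMap := Matrix.toLin'_toMatrix' _
  rw [Matrix.toLin'_mul, Matrix.toLin'_mul, hP]
  refine LinearMap.ext fun v => ?_
  rw [LinearMap.comp_apply, LinearMap.comp_apply, Matrix.toLin'_apply, Matrix.toLin'_apply]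
  exact hL v

end Matrices
-- Modified types and ranks of `(A - 1) * p(A)`
section ModifiedType

variable {k : Type*} [Field k]

/-- The number of boxes in the first `j` columns of a partition. -/
def columnSum (s : Partition) (j : ℕ) : ℕ := (s.map fun i : ℕ+ => min (i : ℕ) j).sum

/-- The size of a multipartition. -/
def multiSize (μ : Multipartition k) : ℕ :=
  μ.sum fun r s => (s.map fun i : ℕ+ => r.1.natDegree * (i : ℕ)).sum

/-- The numbers `ρ(f)` are the ranks of `f` on a module of type `μ`, up to a common constant,
for all powers `f` of monic irreducible polynomials other than `t`. -/
def HasRanks (μ : Multipartition k) (ρ : k[X] → ℕ) : Prop :=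
  ∀ (r : MonicIrred k) (j : ℕ), ρ (r.1 ^ j) + r.1.natDegree * columnSum (μ r) j = ρ 1

theorem MonicIrred.natDegree_pos (r : MonicIrred k) : 0 < r.1.natDegree :=
  r.2.2.1.natDegree_pos

theorem HasRanks.unique {μ ν : Multipartition k} {ρ : k[X] → ℕ} (hμ : HasRanks μ ρ)
    (hν : HasRanks ν ρ) : μ = ν := by
  ext1 r
  refine multiset_ext_of_sum_min fun j => ?_
  have h := (hμ r j).trans (hν r j).symm
  exact Nat.eq_of_mul_eq_mul_left r.natDegree_pos (Nat.add_left_cancel h)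

theorem modify_apply [DecidableEq (MonicIrred k)] (μ : Multipartition k) (r : MonicIrred k) :
    modify μ r = if r = tSubOne k then removeFirstColumn (μ r) else μ r := by
  rw [modify, Finsupp.update_apply]
  split_ifs with h
  · rw [h]
  · rfl

theorem natDegree_tSubOne : (tSubOne k).1.natDegree = 1 := natDegree_X_sub_C 1

theorem multiSize_modify_add_card (μ : Multipartition k) :
    multiSize (modify μ) + (μ (tSubOne k)).card = multiSize μ := by
  classical
  let g : MonicIrred k → Partition → ℕ := fun r s =>
    (s.map fun i : ℕ+ => r.1.natDegree * (i : ℕ)).sum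
  let S := insert (tSubOne k) (μ.support ∪ (modify μ).support)
  have h0 : ∀ r ∈ S, g r 0 = 0 := fun _ _ => by simp [g]
  have h1 : multiSize μ = ∑ r ∈ S, g r (μ r) :=
    Finsupp.sum_of_support_subset _ (Finset.subset_union_left.trans (Finset.subset_insert _ _)) g h0
  have h2 : multiSize (modify μ) = ∑ r ∈ S, g r (modify μ r) :=
    Finsupp.sum_of_support_subset _
      (Finset.subset_union_right.trans (Finset.subset_insert _ _)) g h0
  have h3 : ∀ r ∈ S, g r (μ r) = g r (modify μ r) +
      if r = tSubOne k then (μ (tSubOne k)).card else 0 := by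
    intro r _
    rw [modify_apply]
    split_ifs with h
    · subst h
      simp only [g, natDegree_tSubOne, one_mul]
      rw [sum_map_removeFirstColumn _ (fun i => i) rfl]
      have hcard : (μ (tSubOne k)).card = ((μ (tSubOne k)).map fun _ => 1).sum := by simp
      rw [hcard, ← Multiset.sum_map_add]
      congr 1
      refine Multiset.map_congr rfl fun i _ => ?_
      have := i.pos
      omega
    · rfl
  rw [h1, h2, Finset.sum_congr rfl h3, Finset.sum_add_distrib, Finset.sum_ite_eq' S,
    if_pos (Finset.mem_insert_self _ _)]

variable {n : ℕ}

theorem HasType.multiSize_eq [Finite k] {A : Matrix (Fin n) (Fin n) k} {μ : Multipartition k}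
    (h : HasType A μ) : multiSize μ = n := by
  have := h.rank_aeval_add 0 (fun r i => r.1.natDegree * i) (fun r i => by
    rw [natCard_torsionBy_quotient (pow_ne_zero _ r.2.2.1.ne_zero) (h := r.1 ^ (i : ℕ)) (by simp),
      natDegree_pow, mul_comm])
  rwa [map_zero, Matrix.rank_zero, zero_add] at this

/-- The image of `A - 1` is a module of type `modify μ`: multiplication by `t - 1` shortens each
cyclic summand at `t - 1` by one and is bijective on the others. The last term on the left counts
the boxes of the deleted column. -/
theorem HasType.rank_tSubOne_mul [Finite k] {A : Matrix (Fin n) (Fin n) k} {μ : Multipartition k}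
    (h : HasType A μ) (s : MonicIrred k) (j : ℕ) :
    ((A - 1) * aeval A (s.1 ^ j)).rank + s.1.natDegree * columnSum (modify μ s) j +
      (μ (tSubOne k)).card = n := by
  classical
  -- The exponent of `r` in `(t - 1) * s ^ j`. The case `s = t - 1` needs no exception, since the
  -- exponents add.
  let e : MonicIrred k → ℕ := fun r => (if r = tSubOne k then 1 else 0) + if r = s then j else 0
  have h1 := h.rank_aeval_add ((tSubOne k).1 * s.1 ^ j)
    (fun r i => r.1.natDegree * min (i : ℕ) (e r))
    (fun r i => by
      refine natCard_torsionBy_primePower (e := e r)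
        (f' := (if r = tSubOne k then 1 else (tSubOne k).1) * if r = s then 1 else s.1 ^ j)
        r.2.2.1.ne_zero ?_ ?_
      · simp only [e]
        split_ifs with h1 h2 h2
        · rw [← h1, ← h2]; ring
        · rw [← h1]; ring
        · rw [← h2]; ring
        · ring
      · refine IsCoprime.mul_left ?_ ?_
        · split_ifs with h1
          · exact isCoprime_one_left
          · exact isCoprime_of_ne (Ne.symm h1)
        · split_ifs with h1
          · exact isCoprime_one_left
          · exact (isCoprime_of_ne (Ne.symm h1)).pow_left)
  have h2 : aeval A (tSubOne k).1 = A - 1 := by simp [tSubOne]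
  rw [map_mul, h2] at h1
  have h3 : (μ.sum fun r t => (t.map fun i : ℕ+ => r.1.natDegree * min (i : ℕ) (e r)).sum) =
      s.1.natDegree * columnSum (modify μ s) j + (μ (tSubOne k)).card := by
    let S := insert (tSubOne k) (insert s μ.support)
    rw [Finsupp.sum_of_support_subset (s := S) _
      ((Finset.subset_insert _ _).trans (Finset.subset_insert _ _)) _ (fun _ _ => by simp)]
    have h4 : ∀ r ∈ S, ((μ r).map fun i : ℕ+ => r.1.natDegree * min (i : ℕ) (e r)).sum =
        (if r = s then s.1.natDegree * columnSum (modify μ s) j else 0) +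
          if r = tSubOne k then (μ (tSubOne k)).card else 0 := by
      intro r _
      have hcard : (μ (tSubOne k)).card = ((μ (tSubOne k)).map fun _ => 1).sum := by simp
      rw [Multiset.sum_map_mul_left]
      simp only [e]
      by_cases hr1 : r = tSubOne k <;> by_cases hr2 : r = s
      · subst hr2
        rw [if_pos hr1, if_pos rfl, if_pos rfl, if_pos hr1, modify_apply, if_pos hr1, hcard, ← hr1,
          columnSum, sum_map_removeFirstColumn _ (fun i => min i j) (by simp)]
        have hd : r.1.natDegree = 1 := by rw [hr1, natDegree_tSubOne]
        rw [hd, one_mul, one_mul, ← Multiset.sum_map_add]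
        congr 1
        refine Multiset.map_congr rfl fun i _ => ?_
        have := i.pos
        omega
      · have hd : r.1.natDegree = 1 := by rw [hr1, natDegree_tSubOne]
        rw [if_pos hr1, if_neg hr2, if_neg hr2, if_pos hr1, hcard, ← hr1, hd, one_mul, zero_add]
        congr 1
        refine Multiset.map_congr rfl fun i _ => ?_
        have := i.pos
        omega
      · subst hr2
        rw [if_neg hr1, if_pos rfl, if_pos rfl, if_neg hr1, modify_apply, if_neg hr1, zero_add,
          add_zero, columnSum]
      · rw [if_neg hr1, if_neg hr2, if_neg hr2, if_neg hr1]
        simp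
    rw [Finset.sum_congr rfl h4, Finset.sum_add_distrib, Finset.sum_ite_eq' S,
      Finset.sum_ite_eq' S, if_pos (Finset.mem_insert_self _ _),
      if_pos (Finset.mem_insert_of_mem (Finset.mem_insert_self _ _))]
  rw [h3] at h1
  omega

theorem columnSum_zero (s : Partition) : columnSum s 0 = 0 := by simp [columnSum]

theorem HasType.rank_sub_one_add [Finite k] {A : Matrix (Fin n) (Fin n) k} {μ : Multipartition k}
    (h : HasType A μ) : (A - 1).rank + (μ (tSubOne k)).card = n := by
  have := h.rank_tSubOne_mul (tSubOne k) 0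
  rwa [pow_zero, map_one, mul_one, columnSum_zero, mul_zero, add_zero] at this

theorem HasType.rank_sub_one [Finite k] {A : Matrix (Fin n) (Fin n) k} {μ : Multipartition k}
    (h : HasType A μ) : (A - 1).rank = multiSize (modify μ) := by
  have h1 := h.rank_sub_one_add
  have h2 := h.multiSize_eq
  have h3 := multiSize_modify_add_card μ
  omega

theorem HasModifiedType.rank_sub_one [Finite k] {A : Matrix (Fin n) (Fin n) k}
    {ν : Multipartition k} (h : HasModifiedType A ν) : (A - 1).rank = multiSize ν := by
  obtain ⟨μ, hμ, rfl⟩ := h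
  exact hμ.rank_sub_one

theorem HasType.hasRanks_modify [Finite k] {A : Matrix (Fin n) (Fin n) k} {μ : Multipartition k}
    (h : HasType A μ) : HasRanks (modify μ) fun f => ((A - 1) * aeval A f).rank := by
  intro r j
  have h1 := h.rank_tSubOne_mul r j
  have h2 := h.rank_sub_one_add
  simp only [map_one, mul_one]
  omega

/-- The modified type of an invertible matrix is characterised by ranks. -/
theorem hasModifiedType_iff_hasRanks [Finite k] {A : Matrix (Fin n) (Fin n) k} (hA : IsUnit A)
    (ν : Multipartition k) :
    HasModifiedType A ν ↔ HasRanks ν fun f => ((A - 1) * aeval A f).rank := by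
  constructor
  · rintro ⟨μ, hμ, rfl⟩
    exact hμ.hasRanks_modify
  · intro h
    obtain ⟨μ, hμ⟩ := exists_hasType hA
    exact ⟨μ, hμ, hμ.hasRanks_modify.unique h⟩

theorem eq_of_modify_eq {μ μ' : Multipartition k} (h : modify μ = modify μ')
    (hc : (μ (tSubOne k)).card = (μ' (tSubOne k)).card) : μ = μ' := by
  classical
  ext1 r
  have h1 := DFunLike.congr_fun h r
  rw [modify_apply, modify_apply] at h1
  split_ifs at h1 with hr
  · subst hr
    exact eq_of_removeFirstColumn_eq h1 hc
  · exact h1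

/-- Matrices of the same size and modified type are similar. -/
theorem HasModifiedType.exists_conj [Finite k] {A B : Matrix (Fin n) (Fin n) k}
    {ν : Multipartition k} (hA : HasModifiedType A ν) (hB : HasModifiedType B ν) :
    ∃ P : GL (Fin n) k,
      (P : Matrix (Fin n) (Fin n) k) * A = B * (P : Matrix (Fin n) (Fin n) k) := by
  obtain ⟨μ, hμ, rfl⟩ := hA
  obtain ⟨μ', hμ', h⟩ := hB
  -- The deleted column has length `n - rank (A - 1)`. The rank is determined by the modified type,
  -- so the size restores the type.
  have h1 := hμ.rank_sub_one_add
  have h2 := hμ'.rank_sub_one_add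
  rw [hμ.rank_sub_one] at h1
  rw [hμ'.rank_sub_one, h] at h2
  obtain rfl := eq_of_modify_eq h (by omega)
  exact hμ.exists_conj hμ'

end ModifiedType
-- Hilbert 90 and the norm for finite rings with involution
section Norm

variable {A : Type*} [CommRing A] [Finite A] (σ : A →+* A)

/-- Hilbert 90: `z = c + y * σ c` satisfies `z = y * σ z`, so a unit `z` exhibits `y` as `z / σ z`.
The element `c` is adjusted to avoid the maximal ideals one at a time. -/
theorem exists_isUnit_add_mul (hσ : ∀ x, σ (σ x) = x) (θ : A)
    (hθ : IsUnit (θ - σ θ)) (y : A) (hy : y * σ y = 1) : ∃ c, IsUnit (c + y * σ c) := by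
  classical
  have key : ∀ S : Finset (MaximalSpectrum A), ∃ c, ∀ m ∈ S, c + y * σ c ∉ m.asIdeal := by
    intro S
    induction S using Finset.induction_on with
    | empty => exact ⟨0, by simp⟩
    | insert m S hm ih =>
      obtain ⟨c, hc⟩ := ih
      by_cases hcm : c + y * σ c ∈ m.asIdeal
      swap
      · exact ⟨c, fun n hn => (Finset.mem_insert.1 hn).elim (fun h => h ▸ hcm) (hc n)⟩
      have hmax := m.isMaximal
      have hprime := hmax.isPrime
      have hsurj : Function.Surjective σ := fun x => ⟨σ x, hσ x⟩
      have hS : ∀ n ∈ S, ¬ n.asIdeal ≤ m.asIdeal ∧ ¬ n.asIdeal.comap σ ≤ m.asIdeal := by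
        intro n hn
        refine ⟨fun h => ?_, fun h => ?_⟩
        · have : n = m := MaximalSpectrum.ext (n.isMaximal.eq_of_le hmax.ne_top h)
          exact hm (this ▸ hn)
        · have hn' := Ideal.comap_isMaximal_of_surjective σ hsurj (H := n.isMaximal)
          have heq := hn'.eq_of_le hmax.ne_top h
          apply hc n hn
          -- Applying `σ` to this element gives back `c + y * σ c`. So failure at `m = σ⁻¹ n` would
          -- force failure at `n`, which is excluded.
          have h1 : σ y * (c + y * σ c) ∈ n.asIdeal.comap σ := by
            rw [heq]
            exact Ideal.mul_mem_left _ _ hcm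
          rw [Ideal.mem_comap] at h1
          convert h1 using 1
          rw [map_mul, map_add, map_mul, hσ, hσ]
          linear_combination (-c) * hy
      -- Corrections of `c` by elements of `K` do not affect the ideals already treated.
      obtain ⟨K, hK, hKS⟩ : ∃ K : Ideal A, ¬ K ≤ m.asIdeal ∧
          ∀ n ∈ S, K ≤ n.asIdeal ∧ K ≤ n.asIdeal.comap σ := by
        refine ⟨S.inf fun n => n.asIdeal ⊓ n.asIdeal.comap σ, fun h => ?_, fun n hn => ?_⟩
        · obtain ⟨n, hn, h1⟩ := (Ideal.IsPrime.inf_le' hprime).1 h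
          rcases (Ideal.IsPrime.inf_le hprime).1 h1 with h2 | h2
          · exact (hS n hn).1 h2
          · exact (hS n hn).2 h2
        · exact ⟨(Finset.inf_le hn).trans inf_le_left, (Finset.inf_le hn).trans inf_le_right⟩
      have hKn : ∀ n ∈ S, ∀ e ∈ K, e + y * σ e ∈ n.asIdeal := fun n hn e he =>
        add_mem ((hKS n hn).1 he) (Ideal.mul_mem_left _ _ ((hKS n hn).2 he))
      have hgood : ∀ e ∈ K, e + y * σ e ∉ m.asIdeal →
          ∃ c, ∀ n ∈ insert m S, c + y * σ c ∉ n.asIdeal := by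
        intro e he hem
        refine ⟨c + e, fun n hn hn' => ?_⟩
        have hsplit : c + e + y * σ (c + e) = (c + y * σ c) + (e + y * σ e) := by
          rw [map_add]; ring
        rw [hsplit] at hn'
        rcases Finset.mem_insert.1 hn with rfl | hn
        · exact hem ((Ideal.add_mem_iff_right _ hcm).1 hn')
        · exact hc n hn ((Ideal.add_mem_iff_left _ (hKn n hn e he)).1 hn')
      -- If `m` is `σ`-stable, one of `w = e * σ e` and `w * θ` is a good correction: otherwise `w *
      -- (θ - σ θ)` lies in `m`. If not, choose `e` outside `m` with `σ e` in `m`.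
      by_cases hmm : m.asIdeal.comap σ = m.asIdeal
      · obtain ⟨e, heK, hem⟩ := SetLike.not_le_iff_exists.1 hK
        have hσe : σ e ∉ m.asIdeal := by
          intro h
          exact hem (hmm ▸ Ideal.mem_comap.2 h)
        have hw : e * σ e ∉ m.asIdeal := fun h => (hprime.mem_or_mem h).elim hem hσe
        have hwσ : σ (e * σ e) = e * σ e := by rw [map_mul, hσ, mul_comm]
        have hwK : e * σ e ∈ K := Ideal.mul_mem_right _ _ heK
        by_cases h1 : e * σ e + y * σ (e * σ e) ∈ m.asIdeal
        swap
        · exact hgood _ hwK h1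
        by_cases h2 : e * σ e * θ + y * σ (e * σ e * θ) ∈ m.asIdeal
        swap
        · exact hgood _ (Ideal.mul_mem_right _ _ hwK) h2
        exfalso
        have h3 : e * σ e * (θ - σ θ) ∈ m.asIdeal := by
          have := sub_mem h2 (Ideal.mul_mem_left _ (σ θ) h1)
          rw [map_mul σ (e * σ e), hwσ] at this
          convert this using 1
          ring
        rcases hprime.mem_or_mem h3 with h | h
        · exact hw h
        · exact hmax.ne_top (Ideal.eq_top_of_isUnit_mem _ h hθ)
      · have hmax' := Ideal.comap_isMaximal_of_surjective σ hsurj (H := hmax)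
        have hK' : ¬ K ⊓ m.asIdeal.comap σ ≤ m.asIdeal := by
          intro h
          rcases (Ideal.IsPrime.inf_le hprime).1 h with h | h
          · exact hK h
          · exact hmm (hmax'.eq_of_le hmax.ne_top h)
        obtain ⟨e, heK, hem⟩ := SetLike.not_le_iff_exists.1 hK'
        refine hgood e heK.1 fun h => hem ?_
        have h1 : σ e ∈ m.asIdeal := Ideal.mem_comap.1 heK.2
        exact (Ideal.add_mem_iff_left _ (Ideal.mul_mem_left _ _ h1)).1 h
  have : Finite (MaximalSpectrum A) := inferInstance
  have := Fintype.ofFinite (MaximalSpectrum A)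
  obtain ⟨c, hc⟩ := key Finset.univ
  refine ⟨c, ?_⟩
  by_contra h
  obtain ⟨M, hM, hcM⟩ := exists_max_ideal_of_mem_nonunits h
  exact hc ⟨M, hM⟩ (Finset.mem_univ _) hcM

/-- Surjectivity of the norm for a finite commutative ring with an unramified involution. -/
theorem exists_norm_eq (hσ : ∀ x, σ (σ x) = x) (θ : A) (hθ : IsUnit (θ - σ θ)) (s : A)
    (hs : IsUnit s) (hfix : σ s = s) : ∃ y, σ y * y = s := by
  -- With `N u = σ u * u` and `D u = u / σ u`, Hilbert 90 gives `ker N ≤ range D`. Comparing the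
  -- orders of kernels and ranges upgrades `range N ≤ ker D` to an equality.
  let τ : Aˣ →* Aˣ := Units.map σ
  let N : Aˣ →* Aˣ := τ * MonoidHom.id _
  let D : Aˣ →* Aˣ := MonoidHom.id _ / τ
  have hτ : ∀ u : Aˣ, ((τ u : Aˣ) : A) = σ u := fun _ => rfl
  have hττ : ∀ u : Aˣ, τ (τ u) = u := fun u => Units.ext (hσ u)
  have h1 : N.ker ≤ D.range := by
    intro y hy
    have hy' : τ y * y = 1 := hy
    have hy2 : (y : A) * σ y = 1 := by
      have := congrArg Units.val hy'
      rw [Units.val_mul, hτ, Units.val_one, mul_comm] at this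
      exact this
    obtain ⟨c, z, hz⟩ := exists_isUnit_add_mul σ hσ θ hθ (y : A) hy2
    refine ⟨z, ?_⟩
    change z / τ z = y
    rw [div_eq_iff_eq_mul]
    apply Units.ext
    rw [Units.val_mul, hτ, hz, map_add, map_mul, hσ]
    linear_combination (-c) * hy2
  have h2 : N.range ≤ D.ker := by
    rintro _ ⟨y, rfl⟩
    change (τ y * y) / τ (τ y * y) = 1
    rw [map_mul, hττ, mul_comm y, div_self']
  have c1 := Subgroup.card_mul_index D.ker
  have c2 := Subgroup.card_mul_index N.ker
  rw [Subgroup.index_ker] at c1 c2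
  have c3 : Nat.card N.ker ≤ Nat.card D.range := Subgroup.card_le_of_le h1
  have c4 : 0 < Nat.card D.range := Nat.card_pos
  have c5 : Nat.card D.ker ≤ Nat.card N.range := by
    refine Nat.le_of_mul_le_mul_right ?_ c4
    rw [c1, ← c2, mul_comm]
    exact Nat.mul_le_mul_left _ c3
  have heq := Subgroup.eq_of_le_of_card_ge h2 c5
  obtain ⟨u, rfl⟩ := hs
  have hu : u ∈ D.ker := by
    change u / τ u = 1
    rw [div_eq_one]
    exact Units.ext hfix.symm
  rw [← heq] at hu
  obtain ⟨y, hy⟩ := hu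
  exact ⟨y, congrArg Units.val hy⟩

end Norm

/-! ### Similar unitary matrices are unitarily similar -/

section Conjugacy

variable {k : Type*} [Field k] [StarRing k] {ι : Type*} [Fintype ι] [DecidableEq ι]

theorem conjTranspose_aeval (B : Matrix ι ι k) (p : k[X]) :
    (aeval B p).conjTranspose = aeval B.conjTranspose (p.map (starRingEnd k)) := by
  induction p using Polynomial.induction_on' with
  | add p p' hp hp' =>
    rw [map_add, Matrix.conjTranspose_add, hp, hp', Polynomial.map_add, map_add]
  | monomial i a =>
    rw [Polynomial.map_monomial, aeval_monomial, aeval_monomial, Algebra.algebraMap_eq_smul_one,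
      Algebra.algebraMap_eq_smul_one, smul_mul_assoc, one_mul, smul_mul_assoc, one_mul,
      Matrix.conjTranspose_smul, Matrix.conjTranspose_pow]
    rfl

/-- An invertible Hermitian matrix `B` over a finite field is of the form `yᴴ * y` with `y` a
polynomial in `B`. -/
theorem exists_aeval_conjTranspose_mul_eq [Finite k] (hθ : ∃ t : k, t - star t ≠ 0)
    {B : Matrix ι ι k} (hB : B.conjTranspose = B) (hu : IsUnit B) :
    ∃ p : k[X], (aeval B p).conjTranspose * aeval B p = B := by
  let f : k[X] →+* Matrix ι ι k := (aeval B).toRingHom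
  -- The quotient by `I` is the finite commutative ring `k[B]`. As `B` is Hermitian, conjugating
  -- coefficients realises the conjugate transpose on it, and the scalar `t` shows that this
  -- involution is unramified.
  let I := RingHom.ker f
  have hI : I ≤ I.comap (Polynomial.mapRingHom (starRingEnd k)) := by
    intro p hp
    have hp' : aeval B p = 0 := hp
    have h1 := conjTranspose_aeval B p
    rw [hp', hB, Matrix.conjTranspose_zero] at h1
    exact h1.symm
  let σ : k[X] ⧸ I →+* k[X] ⧸ I := Ideal.quotientMap I (Polynomial.mapRingHom (starRingEnd k)) hI
  have hinj : Function.Injective (RingHom.kerLift f) := RingHom.kerLift_injective f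
  have : Finite (k[X] ⧸ I) := Finite.of_injective _ hinj
  have hσmk : ∀ p : k[X], σ (Ideal.Quotient.mk I p) =
      Ideal.Quotient.mk I (p.map (starRingEnd k)) := fun p => Ideal.quotientMap_mk
  have hσ : ∀ x, σ (σ x) = x := by
    intro x
    obtain ⟨p, rfl⟩ := Ideal.Quotient.mk_surjective x
    rw [hσmk, hσmk, Polynomial.map_map,
      RingHom.ext (f := (starRingEnd k).comp (starRingEnd k)) (g := RingHom.id k) star_star,
      Polynomial.map_id]
  obtain ⟨t, ht⟩ := hθ
  have hs : IsUnit (Ideal.Quotient.mk I X) := by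
    obtain ⟨u, hu⟩ := hu
    have hpow : B ^ orderOf u = 1 := by
      rw [← hu, ← Units.val_pow_eq_pow_val, pow_orderOf_eq_one, Units.val_one]
    have hpos : 0 < orderOf u := orderOf_pos u
    refine IsUnit.of_pow_eq_one (n := orderOf u) ?_ hpos.ne'
    apply hinj
    rw [map_pow, map_one]
    have : RingHom.kerLift f (Ideal.Quotient.mk I X) = B := by
      rw [RingHom.kerLift_mk]
      exact aeval_X B
    rw [this, hpow]
  obtain ⟨y, hy⟩ := exists_norm_eq σ hσ (Ideal.Quotient.mk I (C t)) (by
    rw [hσmk, map_C, ← map_sub, ← C_sub]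
    exact ((IsUnit.mk0 _ ht).map C).map _) (Ideal.Quotient.mk I X) hs (by
    rw [hσmk, map_X])
  obtain ⟨p, rfl⟩ := Ideal.Quotient.mk_surjective y
  rw [hσmk, ← map_mul, Ideal.Quotient.eq] at hy
  have h1 : aeval B (p.map (starRingEnd k) * p - X) = 0 := hy
  rw [map_sub, map_mul, aeval_X, sub_eq_zero] at h1
  refine ⟨p, ?_⟩
  rw [conjTranspose_aeval, hB, h1]

/-- Unitary matrices that are similar are unitarily similar. -/
theorem exists_unitary_conj [Finite k] (hθ : ∃ t : k, t - star t ≠ 0)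
    {g h P : Matrix ι ι k} (hg : g.conjTranspose * g = 1) (hh : h.conjTranspose * h = 1)
    (hP : IsUnit P) (hPg : P * g = h * P) :
    ∃ U : Matrix ι ι k, U.conjTranspose * U = 1 ∧ U * g = h * U := by
  have hg' : g * g.conjTranspose = 1 := mul_eq_one_comm.1 hg
  have h1 : P.conjTranspose * h = g * P.conjTranspose := by
    have h2 : g.conjTranspose * P.conjTranspose = P.conjTranspose * h.conjTranspose := by
      rw [← Matrix.conjTranspose_mul, hPg, Matrix.conjTranspose_mul]
    calc P.conjTranspose * h = g * g.conjTranspose * P.conjTranspose * h := by rw [hg', one_mul]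
      _ = g * (P.conjTranspose * h.conjTranspose) * h := by rw [← h2]; simp only [mul_assoc]
      _ = g * P.conjTranspose := by rw [mul_assoc, mul_assoc, hh, mul_one]
  have hcomm : Commute (P.conjTranspose * P) g := by
    change P.conjTranspose * P * g = g * (P.conjTranspose * P)
    rw [mul_assoc, hPg, ← mul_assoc, h1, mul_assoc]
  have hPs : IsUnit P.conjTranspose := by
    rw [← Matrix.star_eq_conjTranspose]
    exact hP.star
  -- A polar decomposition of `P`: the factor `y` commutes with `g`, being a polynomial in `Pᴴ * P`,
  -- and `P * y⁻¹` is unitary.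
  obtain ⟨p, hp⟩ := exists_aeval_conjTranspose_mul_eq hθ (B := P.conjTranspose * P)
    (by rw [Matrix.conjTranspose_mul, Matrix.conjTranspose_conjTranspose]) (hPs.mul hP)
  set y := aeval (P.conjTranspose * P) p with hy
  have hyg : Commute y g := by
    rw [hy, aeval_eq_sum_range]
    exact Commute.sum_left _ _ _ fun i _ => (hcomm.pow_left i).smul_left _
  have hyu : IsUnit y := by
    have : IsUnit (y.conjTranspose * y) := by rw [hp]; exact hPs.mul hP
    rw [Matrix.isUnit_iff_isUnit_det] at this ⊢
    rw [Matrix.det_mul] at this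
    exact isUnit_of_mul_isUnit_right this
  obtain ⟨u, hu⟩ := hyu
  have hug : Commute ((u⁻¹ : (Matrix ι ι k)ˣ) : Matrix ι ι k) g := by
    rw [← hu] at hyg
    exact hyg.units_inv_left
  refine ⟨P * ((u⁻¹ : (Matrix ι ι k)ˣ) : Matrix ι ι k), ?_, ?_⟩
  · have h3 : y * ((u⁻¹ : (Matrix ι ι k)ˣ) : Matrix ι ι k) = 1 := by rw [← hu, Units.mul_inv]
    have h4 : ((u⁻¹ : (Matrix ι ι k)ˣ) : Matrix ι ι k).conjTranspose * y.conjTranspose = 1 := by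
      rw [← Matrix.conjTranspose_mul, h3, Matrix.conjTranspose_one]
    rw [Matrix.conjTranspose_mul, mul_assoc, ← mul_assoc P.conjTranspose, ← hp, mul_assoc, h3,
      mul_one, h4]
  · rw [mul_assoc, hug.eq, ← mul_assoc, hPg, mul_assoc]

end Conjugacy

/-! ### Invariance of modified types under `*` -/

section StarInvariance

variable {k : Type*} [Field k] {q : ℕ}

theorem coeff_zero_ne_zero (r : MonicIrred k) : r.1.coeff 0 ≠ 0 := by
  intro h
  have h1 : X ∣ r.1 := X_dvd_iff.2 h
  exact r.2.2.2 (eq_of_monic_of_associated r.2.1 monic_X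
    ((irreducible_X.dvd_irreducible_iff_associated r.2.2.1).1 h1).symm)

theorem natDegree_eq_of_starPoly {r s : MonicIrred k} (h : s.1 = starPoly q r.1) :
    s.1.natDegree = r.1.natDegree := by
  rw [h, starPoly, natDegree_C_mul (inv_ne_zero (pow_ne_zero _ (coeff_zero_ne_zero r)))]
  apply natDegree_eq_of_le_of_coeff_ne_zero
  · exact natDegree_sum_le_of_forall_le _ _ fun i _ =>
      (natDegree_C_mul_X_pow_le _ _).trans (Nat.sub_le _ _)
  · rw [finsetSum_coeff, Finset.sum_eq_single 0]
    · rw [Nat.sub_zero, coeff_C_mul_X_pow, if_pos rfl]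
      exact pow_ne_zero q (coeff_zero_ne_zero r)
    · intro i hi hi0
      rw [coeff_C_mul_X_pow, if_neg]
      have := Finset.mem_range.1 hi
      omega
    · simp

theorem exists_rank_factorization {ι κ : Type*} [Fintype ι] [DecidableEq ι] [Fintype κ]
    [DecidableEq κ] (B : Matrix ι κ k) : ∃ (u : Matrix ι (Fin B.rank) k)
      (P : Matrix (Fin B.rank) κ k), (∃ L : Matrix (Fin B.rank) ι k, L * u = 1) ∧ B = u * P := by
  let T := LinearMap.range B.mulVecLin
  let e : (Fin B.rank → k) ≃ₗ[k] T := LinearEquiv.ofFinrankEq _ _ (Module.finrank_fin_fun k)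
  have hr : LinearMap.range (LinearMap.toMatrix' (T.subtype.comp e.toLinearMap)).mulVecLin = T := by
    rw [← Matrix.toLin'_apply' (LinearMap.toMatrix' _), Matrix.toLin'_toMatrix',
      LinearMap.range_comp_of_range_eq_top _ (LinearEquiv.range e), Submodule.range_subtype]
  obtain ⟨P, hP⟩ := exists_eq_mul_of_range_le (A := B) hr.ge
  refine ⟨_, P, ?_, hP⟩
  rw [exists_leftInverse_iff_rank, Matrix.rank, hr]
  exact (Fintype.card_fin _).symm

variable [StarRing k]

theorem rank_conjTranspose_le {ι κ : Type*} [Fintype ι] [DecidableEq ι] [Fintype κ]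
    [DecidableEq κ] (B : Matrix ι κ k) : B.conjTranspose.rank ≤ B.rank := by
  obtain ⟨u, P, -, hP⟩ := exists_rank_factorization B
  have h1 : B.conjTranspose = P.conjTranspose * u.conjTranspose := by
    rw [← Matrix.conjTranspose_mul, ← hP]
  rw [h1]
  exact (Matrix.rank_mul_le_left _ _).trans (by simpa using P.conjTranspose.rank_le_card_width)

theorem rank_conjTranspose_eq {ι κ : Type*} [Fintype ι] [DecidableEq ι] [Fintype κ]
    [DecidableEq κ] (B : Matrix ι κ k) : B.conjTranspose.rank = B.rank := by
  refine le_antisymm (rank_conjTranspose_le B) ?_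
  simpa using rank_conjTranspose_le B.conjTranspose

variable {ι : Type*} [Fintype ι] [DecidableEq ι]

/-- Since `Bᴴ = B⁻¹`, conjugate transposition turns `B ^ i` into `B ^ (-i)`, which is the
substitution defining `r*`. -/
theorem aeval_starPoly (hs : ∀ x : k, star x = x ^ q) {B : Matrix ι ι k}
    (hB : B * B.conjTranspose = 1) (r : k[X]) :
    aeval B (starPoly q r) =
      (r.coeff 0 ^ q)⁻¹ • (B ^ r.natDegree * (aeval B r).conjTranspose) := by
  have hpow : ∀ i, B ^ i * B.conjTranspose ^ i = 1 := by
    intro i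
    induction i with
    | zero => simp
    | succ i ih =>
      rw [pow_succ, pow_succ', mul_assoc, ← mul_assoc B, hB, one_mul, ih]
  rw [starPoly, map_mul, aeval_C, Algebra.algebraMap_eq_smul_one, smul_mul_assoc, one_mul]
  congr 1
  rw [aeval_eq_sum_range (p := r), Matrix.conjTranspose_sum, Finset.mul_sum, map_sum]
  refine Finset.sum_congr rfl fun i hi => ?_
  have hi' : i ≤ r.natDegree := Nat.lt_succ_iff.1 (Finset.mem_range.1 hi)
  rw [map_mul, aeval_C, map_pow (aeval B) X, aeval_X, Algebra.algebraMap_eq_smul_one,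
    smul_mul_assoc, one_mul,
    Matrix.conjTranspose_smul, Matrix.conjTranspose_pow, Matrix.mul_smul, hs]
  congr 1
  obtain ⟨t, ht⟩ := Nat.exists_eq_add_of_le' hi'
  rw [ht, Nat.add_sub_cancel, pow_add, mul_assoc, hpow, mul_one]

/-- The modified type of a unitary matrix is invariant under `*`. -/
theorem isStarInvariant_of_hasRanks (hs : ∀ x : k, star x = x ^ q) {B : Matrix ι ι k}
    (hB : B.conjTranspose * B = 1) {ν : Multipartition k}
    (hν : HasRanks ν fun f => ((B - 1) * aeval B f).rank) : IsStarInvariant q ν := by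
  intro r s hrs
  have hB' : B * B.conjTranspose = 1 := mul_eq_one_comm.1 hB
  have hu : IsUnit B := IsUnit.of_mul_eq_one _ hB'
  have hcomm : ∀ p : k[X], Commute B (aeval B p).conjTranspose := by
    intro p
    rw [conjTranspose_aeval, aeval_eq_sum_range]
    refine Commute.sum_right _ _ _ fun i _ => ?_
    have : Commute B B.conjTranspose := hB'.trans hB.symm
    exact (this.pow_right i).smul_right _
  have hrank : ∀ j, ((B - 1) * aeval B (s.1 ^ j)).rank = ((B - 1) * aeval B (r.1 ^ j)).rank := by
    intro j
    have hc : (r.1.coeff 0 ^ q)⁻¹ ^ j ≠ 0 :=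
      pow_ne_zero _ (inv_ne_zero (pow_ne_zero _ (coeff_zero_ne_zero r)))
    have h1 : (B - 1) * aeval B (s.1 ^ j) = ((r.1.coeff 0 ^ q)⁻¹ ^ j) •
        ((-(B * B ^ (r.1.natDegree * j))) * (aeval B (r.1 ^ j) * (B - 1)).conjTranspose) := by
      -- Hence `(B - 1) * s(B) ^ j` is an invertible matrix times the conjugate transpose of `r(B) ^
      -- j * (B - 1)`, and the two ranks agree.
      have h2 : B - 1 = -B * (B - 1).conjTranspose := by
        rw [Matrix.conjTranspose_sub, Matrix.conjTranspose_one, mul_sub, neg_mul, hB', mul_one]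
        abel
      have h3 : aeval B (s.1 ^ j) = (r.1.coeff 0 ^ q)⁻¹ ^ j •
          (B ^ (r.1.natDegree * j) * (aeval B (r.1 ^ j)).conjTranspose) := by
        rw [map_pow, hrs, aeval_starPoly hs hB', _root_.smul_pow,
          ((hcomm r.1).pow_left _).mul_pow, ← pow_mul, map_pow, Matrix.conjTranspose_pow]
      have h4 : Commute (B - 1).conjTranspose (B ^ (r.1.natDegree * j)) := by
        have := (hcomm (X - 1)).symm.pow_right (r.1.natDegree * j)
        simpa using this
      rw [h3, Matrix.mul_smul]
      congr 1
      rw [Matrix.conjTranspose_mul]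
      conv_lhs => rw [h2]
      simp only [neg_mul, mul_assoc]
      rw [← mul_assoc _ (B ^ _), h4.eq, mul_assoc]
    rw [h1, ← Matrix.smul_mul]
    have hu2 : IsUnit ((r.1.coeff 0 ^ q)⁻¹ ^ j • (-(B * B ^ (r.1.natDegree * j)))) :=
      ((hu.mul (hu.pow _)).neg).smul (Units.mk0 _ hc)
    rw [Matrix.rank_mul_eq_right_of_isUnit_det _ _ ((Matrix.isUnit_iff_isUnit_det _).1 hu2),
      rank_conjTranspose_eq]
    congr 1
    have : Commute (aeval B (r.1 ^ j)) (aeval B (X - 1 : k[X])) := by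
      change aeval B _ * aeval B _ = aeval B _ * aeval B _
      rw [← map_mul, mul_comm, map_mul]
    simpa using this.eq
  refine multiset_ext_of_sum_min fun j => ?_
  have h1 := (hν r j).trans (hν s j).symm
  simp only [hrank] at h1
  rw [natDegree_eq_of_starPoly hrs] at h1
  exact Nat.eq_of_mul_eq_mul_left r.natDegree_pos (Nat.add_left_cancel h1)

end StarInvariance
-- Unitary matrices in coordinates `1 + f * x * fᴴ`
section Frames

variable {k : Type*} [Field k]

theorem mul_aeval_of_mul_eq {ι κ : Type*} [Fintype ι] [DecidableEq ι] [Fintype κ] [DecidableEq κ]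
    {M : Matrix κ ι k} {A : Matrix ι ι k} {B : Matrix κ κ k} (h : M * A = B * M) (p : k[X]) :
    M * aeval A p = aeval B p * M := by
  have hpow : ∀ i : ℕ, M * A ^ i = B ^ i * M := by
    intro i
    induction i with
    | zero => simp
    | succ i ih => rw [pow_succ, ← Matrix.mul_assoc, ih, Matrix.mul_assoc, h, ← Matrix.mul_assoc,
        ← pow_succ]
  rw [aeval_eq_sum_range, aeval_eq_sum_range, Matrix.mul_sum, Matrix.sum_mul]
  refine Finset.sum_congr rfl fun i _ => ?_
  rw [Matrix.mul_smul, hpow, Matrix.smul_mul]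

/-- The rank of `(g - 1) * p(g)`. -/
noncomputable def subOneRank {ι : Type*} [Fintype ι] [DecidableEq ι] (g : Matrix ι ι k)
    (p : k[X]) : ℕ :=
  ((g - 1) * aeval g p).rank

variable [StarRing k]

/-- The rank of `(g - 1) * p(g)` for `g = 1 + f * x * fᴴ`, where `G = fᴴ * f`. -/
noncomputable def frameRank {κ : Type*} [Fintype κ] [DecidableEq κ] (G x : Matrix κ κ k)
    (p : k[X]) : ℕ :=
  (x * aeval (1 + G * x) p).rank

variable {ι κ : Type*} [Fintype ι] [DecidableEq ι] [Fintype κ] [DecidableEq κ]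

theorem conjTranspose_rightInverse {ι κ : Type*} [Fintype ι] [DecidableEq κ]
    {f : Matrix ι κ k} (hf : ∃ L : Matrix κ ι k, L * f = 1) :
    ∃ L : Matrix ι κ k, f.conjTranspose * L = 1 := by
  obtain ⟨L, hL⟩ := hf
  exact ⟨L.conjTranspose, by rw [← Matrix.conjTranspose_mul, hL, Matrix.conjTranspose_one]⟩

theorem frame_cancel {ι κ : Type*} [Fintype ι] [Fintype κ] [DecidableEq κ]
    {f : Matrix ι κ k} (hf : ∃ L : Matrix κ ι k, L * f = 1) {x y : Matrix κ κ k}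
    (h : f * x * f.conjTranspose = f * y * f.conjTranspose) : x = y :=
  mul_left_cancel_of_leftInverse hf
    (mul_right_cancel_of_rightInverse (conjTranspose_rightInverse hf) h)

/-- `fᴴ` intertwines `1 + f * x * fᴴ` with the small matrix `1 + fᴴ * f * x`, so only `x` and the
Gram matrix matter. -/
theorem subOneRank_frame {f : Matrix ι κ k} (hf : ∃ L : Matrix κ ι k, L * f = 1)
    (x : Matrix κ κ k) (p : k[X]) :
    subOneRank (1 + f * x * f.conjTranspose) p = frameRank (f.conjTranspose * f) x p := by
  have h : f.conjTranspose * (1 + f * x * f.conjTranspose) =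
      (1 + f.conjTranspose * f * x) * f.conjTranspose := by
    simp only [Matrix.mul_add, Matrix.add_mul, Matrix.mul_one, Matrix.one_mul, Matrix.mul_assoc]
  rw [subOneRank, frameRank, add_sub_cancel_left, Matrix.mul_assoc, mul_aeval_of_mul_eq h,
    ← Matrix.mul_assoc, rank_mul_of_rightInverse (conjTranspose_rightInverse hf), Matrix.mul_assoc,
    rank_mul_of_leftInverse hf]

theorem conjTranspose_frame_mul {ι κ : Type*} [Fintype ι] [DecidableEq ι] [Fintype κ]
    (f : Matrix ι κ k) (x y : Matrix κ κ k) :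
    (1 + f * x * f.conjTranspose).conjTranspose * (1 + f * y * f.conjTranspose) =
      1 + f * (x.conjTranspose + y + x.conjTranspose * (f.conjTranspose * f) * y) *
        f.conjTranspose := by
  simp only [Matrix.conjTranspose_add, Matrix.conjTranspose_one, Matrix.conjTranspose_mul,
    Matrix.conjTranspose_conjTranspose, Matrix.mul_add, Matrix.add_mul, Matrix.mul_one,
    Matrix.one_mul, Matrix.mul_assoc]
  abel

theorem frame_unitary_iff {f : Matrix ι κ k} (hf : ∃ L : Matrix κ ι k, L * f = 1)
    (x : Matrix κ κ k) :
    (1 + f * x * f.conjTranspose).conjTranspose * (1 + f * x * f.conjTranspose) = 1 ↔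
      x.conjTranspose + x + x.conjTranspose * (f.conjTranspose * f) * x = 0 := by
  rw [conjTranspose_frame_mul, add_eq_left]
  constructor
  · intro h
    exact frame_cancel hf (h.trans (by simp))
  · intro h
    rw [h, Matrix.mul_zero, Matrix.zero_mul]

/-- A unitary `g` with `g - 1 = f * R` is of the form `1 + f * x * fᴴ`. -/
theorem exists_frame_eq {f : Matrix ι κ k} (hf : ∃ L : Matrix κ ι k, L * f = 1)
    {g : Matrix ι ι k} (hg : g.conjTranspose * g = 1) {R : Matrix κ ι k} (hR : g - 1 = f * R) :
    ∃ x : Matrix κ κ k, g = 1 + f * x * f.conjTranspose := by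
  obtain ⟨L, hL⟩ := hf
  have hg' : g * g.conjTranspose = 1 := mul_eq_one_comm.1 hg
  -- `(g - 1)ᴴ = -(g - 1) * gᴴ`, so the range of `f` also contains the columns of `(g - 1)ᴴ`, and `g
  -- - 1` factors through `fᴴ` on the right.
  have h1 : (g - 1).conjTranspose = f * (-(R * g.conjTranspose)) := by
    rw [Matrix.mul_neg, ← Matrix.mul_assoc, ← hR, Matrix.conjTranspose_sub,
      Matrix.conjTranspose_one, Matrix.sub_mul, hg', Matrix.one_mul, neg_sub]
  have h2 : g - 1 = (-(R * g.conjTranspose)).conjTranspose * f.conjTranspose := by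
    rw [← Matrix.conjTranspose_mul, ← h1, Matrix.conjTranspose_conjTranspose]
  refine ⟨L * (-(R * g.conjTranspose)).conjTranspose, ?_⟩
  have h3 : R = L * (-(R * g.conjTranspose)).conjTranspose * f.conjTranspose := by
    rw [Matrix.mul_assoc, ← h2, hR, ← Matrix.mul_assoc, hL, Matrix.one_mul]
  rw [Matrix.mul_assoc f, ← h3, ← hR, add_sub_cancel]

end Frames

/-! ### Frames `1 ⊕ v` adapted to `z ⊕ 1` -/

section SplitFrames

variable {k : Type*} [Field k] {a d m : ℕ}

/-- The block matrix with blocks `1` and `v`. -/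
def splitFrame (a : ℕ) (v : Matrix (Fin m) (Fin d) k) :
    Matrix (Fin a ⊕ Fin m) (Fin a ⊕ Fin d) k :=
  Matrix.fromBlocks 1 0 0 v

theorem splitFrame_leftInverse {v : Matrix (Fin m) (Fin d) k}
    (hv : ∃ L : Matrix (Fin d) (Fin m) k, L * v = 1) :
    ∃ L : Matrix (Fin a ⊕ Fin d) (Fin a ⊕ Fin m) k, L * splitFrame a v = 1 := by
  obtain ⟨L, hL⟩ := hv
  exact ⟨splitFrame a L, by simp [splitFrame, Matrix.fromBlocks_multiply, hL]⟩

variable [StarRing k]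

theorem splitFrame_gram (v : Matrix (Fin m) (Fin d) k) :
    (splitFrame a v).conjTranspose * splitFrame a v = splitFrame a (v.conjTranspose * v) := by
  simp [splitFrame, Matrix.fromBlocks_conjTranspose, Matrix.fromBlocks_multiply]

/-- The direct sum of a matrix and an identity matrix. -/
def stabilize (m : ℕ) (z : Matrix (Fin a) (Fin a) k) : Matrix (Fin a ⊕ Fin m) (Fin a ⊕ Fin m) k :=
  Matrix.fromBlocks z 0 0 1

/-- The extension of a matrix by zero. -/
def corner (d : ℕ) (w : Matrix (Fin a) (Fin a) k) : Matrix (Fin a ⊕ Fin d) (Fin a ⊕ Fin d) k :=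
  Matrix.fromBlocks w 0 0 0

/-- Puts `z ⊕ 1` in the same coordinates as `g`, whatever `v` is. -/
theorem stabilize_eq_frame (z : Matrix (Fin a) (Fin a) k) (v : Matrix (Fin m) (Fin d) k) :
    stabilize m z = 1 + splitFrame a v * corner d (z - 1) *
      (splitFrame a v).conjTranspose := by
  simp [stabilize, splitFrame, corner, Matrix.fromBlocks_conjTranspose, Matrix.fromBlocks_multiply,
    ← Matrix.fromBlocks_one, Matrix.fromBlocks_add]

theorem toRows₂_frame (v : Matrix (Fin m) (Fin d) k)
    (x : Matrix (Fin a ⊕ Fin d) (Fin a ⊕ Fin d) k) :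
    (splitFrame a v * x * (splitFrame a v).conjTranspose).toRows₂ =
      v * x.toRows₂ * (splitFrame a v).conjTranspose := by
  ext i j
  simp only [Matrix.toRows₂_apply, Matrix.mul_apply, splitFrame, Fintype.sum_sum_type,
    Matrix.fromBlocks_apply₂₁, Matrix.fromBlocks_apply₂₂, Matrix.zero_apply, zero_mul,
    Finset.sum_const_zero, zero_add]

theorem rank_toRows₂_frame {v : Matrix (Fin m) (Fin d) k}
    (hv : ∃ L : Matrix (Fin d) (Fin m) k, L * v = 1)
    (x : Matrix (Fin a ⊕ Fin d) (Fin a ⊕ Fin d) k) :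
    (splitFrame a v * x * (splitFrame a v).conjTranspose).toRows₂.rank = x.toRows₂.rank := by
  rw [toRows₂_frame, rank_mul_of_rightInverse (conjTranspose_rightInverse
    (splitFrame_leftInverse hv)), rank_mul_of_leftInverse hv]

/-- Recovers the column space of `v` from `g`: the frame is then unique up to the choice of a basis.
-/
theorem range_toRows₂_frame {v : Matrix (Fin m) (Fin d) k}
    (hv : ∃ L : Matrix (Fin d) (Fin m) k, L * v = 1)
    (x : Matrix (Fin a ⊕ Fin d) (Fin a ⊕ Fin d) k) (hx : x.toRows₂.rank = d) :
    LinearMap.range (splitFrame a v * x * (splitFrame a v).conjTranspose).toRows₂.mulVecLin =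
      LinearMap.range v.mulVecLin := by
  rw [toRows₂_frame, Matrix.mul_assoc, range_mul_of_range_eq_top]
  rw [range_eq_top_iff_rank, rank_mul_of_rightInverse (conjTranspose_rightInverse
    (splitFrame_leftInverse hv)), hx, Fintype.card_fin]

/-- The upper block of the frame is an identity, so only the lower rows of `g - 1` impose a
condition. -/
theorem exists_splitFrame_eq {v : Matrix (Fin m) (Fin d) k}
    (hv : ∃ L : Matrix (Fin d) (Fin m) k, L * v = 1)
    {g : Matrix (Fin a ⊕ Fin m) (Fin a ⊕ Fin m) k} (hg : g.conjTranspose * g = 1)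
    (hle : LinearMap.range (g - 1).toRows₂.mulVecLin ≤ LinearMap.range v.mulVecLin) :
    ∃ x : Matrix (Fin a ⊕ Fin d) (Fin a ⊕ Fin d) k,
      g = 1 + splitFrame a v * x * (splitFrame a v).conjTranspose := by
  obtain ⟨R, hR⟩ := exists_eq_mul_of_range_le hle
  refine exists_frame_eq (splitFrame_leftInverse hv) hg
    (R := Matrix.fromRows (g - 1).toRows₁ R) ?_
  rw [splitFrame, ← Matrix.fromRows_fromCols_eq_fromBlocks, Matrix.fromRows_mul,
    Matrix.fromCols_mul_fromRows, Matrix.fromCols_mul_fromRows, Matrix.one_mul, Matrix.zero_mul,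
    Matrix.zero_mul, add_zero, zero_add, ← hR, Matrix.fromRows_toRows]

end SplitFrames

/-! ### Counting factorisations of `z ⊕ 1` -/

section Count

variable {k : Type*} [Field k] [StarRing k] {q a : ℕ}

/-- The unitary `g` of modified type `μ` such that `g⁻¹ * (z ⊕ 1)` has modified type `ν`. -/
def IsFactor (μ ν : Multipartition k) (z : Matrix (Fin a) (Fin a) k) (m : ℕ)
    (g : Matrix (Fin a ⊕ Fin m) (Fin a ⊕ Fin m) k) : Prop :=
  g.conjTranspose * g = 1 ∧ HasRanks μ (subOneRank g) ∧
    HasRanks ν (subOneRank (g.conjTranspose * stabilize m z))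

/-- The condition on the coordinates `x` of `g = 1 + f * x * fᴴ` for `IsFactor`. -/
def IsFactorCoord (μ ν : Multipartition k) (z : Matrix (Fin a) (Fin a) k) (d : ℕ)
    (H : Matrix (Fin d) (Fin d) k) (x : Matrix (Fin a ⊕ Fin d) (Fin a ⊕ Fin d) k) : Prop :=
  x.conjTranspose + x + x.conjTranspose * splitFrame a H * x = 0 ∧
    HasRanks μ (frameRank (splitFrame a H) x) ∧
    HasRanks ν (frameRank (splitFrame a H) (x.conjTranspose + corner d (z - 1) +
      x.conjTranspose * splitFrame a H * corner d (z - 1)))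

theorem isFactor_frame_iff (μ ν : Multipartition k) (z : Matrix (Fin a) (Fin a) k) {m d : ℕ}
    {v : Matrix (Fin m) (Fin d) k} (hv : ∃ L : Matrix (Fin d) (Fin m) k, L * v = 1)
    (x : Matrix (Fin a ⊕ Fin d) (Fin a ⊕ Fin d) k) :
    IsFactor μ ν z m (1 + splitFrame a v * x * (splitFrame a v).conjTranspose) ↔
      IsFactorCoord μ ν z d (v.conjTranspose * v) x := by
  have hf := splitFrame_leftInverse (a := a) hv
  rw [IsFactor, IsFactorCoord, frame_unitary_iff hf, stabilize_eq_frame z v,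
    conjTranspose_frame_mul, splitFrame_gram]
  have h := fun y => funext (subOneRank_frame hf y)
  rw [splitFrame_gram] at h
  rw [h, h]

/-- Over a fixed `g`, the matrix `v` ranges over the bases of the range of the lower rows of `g -
1`; it determines `H`, and together with `g` it determines `x`. -/
theorem card_isFactor_rank_mul [Finite k] (μ ν : Multipartition k) (z : Matrix (Fin a) (Fin a) k)
    (m d : ℕ) :
    Nat.card {g : {g // IsFactor μ ν z m g} // (g.1 - 1).toRows₂.rank = d} *
        Nat.card ((Fin d → k) ≃ₗ[k] (Fin d → k)) =
      Nat.card (Σ H : Matrix (Fin d) (Fin d) k,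
        {v : Matrix (Fin m) (Fin d) k // (∃ L : Matrix (Fin d) (Fin m) k, L * v = 1) ∧
          v.conjTranspose * v = H} ×
        {x : Matrix (Fin a ⊕ Fin d) (Fin a ⊕ Fin d) k //
          IsFactorCoord μ ν z d H x ∧ x.toRows₂.rank = d}) := by
  symm
  refine card_eq_mul_of_card_fiber (fun x => ⟨⟨1 + splitFrame a x.2.1.1 * x.2.2.1 *
    (splitFrame a x.2.1.1).conjTranspose, ?_⟩, ?_⟩) _ ?_
  rotate_left
  · rw [isFactor_frame_iff μ ν z x.2.1.2.1, x.2.1.2.2]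
    exact x.2.2.2.1
  · change (1 + splitFrame a x.2.1.1 * x.2.2.1 *
      (splitFrame a x.2.1.1).conjTranspose - 1).toRows₂.rank = d
    rw [add_sub_cancel_left, rank_toRows₂_frame x.2.1.2.1]
    exact x.2.2.2.2
  · rintro ⟨⟨g, hg⟩, hr⟩
    rw [← card_bases (LinearMap.range (g - 1).toRows₂.mulVecLin) hr]
    refine Nat.card_congr (Equiv.ofBijective (fun x => ⟨x.1.2.1.1, x.1.2.1.2.1, ?_⟩) ⟨?_, ?_⟩)
    · obtain ⟨⟨H, ⟨v, hv⟩, ⟨x, hx⟩⟩, hy⟩ := x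
      have hy' : 1 + splitFrame a v * x * (splitFrame a v).conjTranspose = g :=
        congrArg (fun z => z.1.1) hy
      rw [← eq_sub_iff_add_eq'] at hy'
      refine (range_toRows₂_frame (a := a) hv.1 x hx.2).symm.trans ?_
      rw [hy']
    · rintro ⟨⟨H, ⟨v, hv⟩, ⟨x, hx⟩⟩, hy⟩ ⟨⟨H', ⟨v', hv'⟩, ⟨x', hx'⟩⟩, hy'⟩ h
      have h' : v = v' := congrArg Subtype.val h
      subst h'
      have h1 : 1 + splitFrame a v * x * (splitFrame a v).conjTranspose = g :=
        congrArg (fun z => z.1.1) hy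
      have h2 : 1 + splitFrame a v * x' * (splitFrame a v).conjTranspose = g :=
        congrArg (fun z => z.1.1) hy'
      obtain rfl : x = x' := frame_cancel (splitFrame_leftInverse hv.1)
        (add_left_cancel (h1.trans h2.symm))
      obtain rfl : H = H' := hv.2.symm.trans hv'.2
      rfl
    · rintro ⟨v, hv, hrv⟩
      have hex : ∃ x : Matrix (Fin a ⊕ Fin d) (Fin a ⊕ Fin d) k,
          g = 1 + splitFrame a v * x * (splitFrame a v).conjTranspose ∧
          IsFactorCoord μ ν z d (v.conjTranspose * v) x ∧ x.toRows₂.rank = d := by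
        obtain ⟨x, hx⟩ := exists_splitFrame_eq hv hg.1 hrv.ge
        refine ⟨x, hx, ?_, ?_⟩
        · rw [← isFactor_frame_iff μ ν z hv, ← hx]
          exact hg
        · rw [← rank_toRows₂_frame hv, eq_sub_iff_add_eq'.2 hx.symm]
          exact hr
      obtain ⟨x, hx, hx'⟩ := hex
      exact ⟨⟨⟨v.conjTranspose * v, ⟨v, hv, rfl⟩, ⟨x, hx'⟩⟩,
        Subtype.ext (Subtype.ext hx.symm)⟩, rfl⟩

/-- The number of factorisations is a polynomial in `(-q) ^ m`. -/
theorem isPolyInPow_card_isFactor [Fintype k] (hk : Fintype.card k = q ^ 2)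
    (hs : ∀ x : k, star x = x ^ q) (μ ν : Multipartition k) (z : Matrix (Fin a) (Fin a) k) (D : ℕ)
    (hD : ∀ m g, IsFactor μ ν z m g → (g - 1).rank ≤ D) :
    IsPolyInPow q fun m => (Nat.card {g // IsFactor μ ν z m g} : ℂ) := by
  classical
  -- The bound `D` makes the range of `d` independent of `m`, as is the number of coordinates `x`;
  -- only the number of `v` depends on `m`.
  have h1 := IsPolyInPow.sum (q := q) (Finset.range (D + 1))
    (F := fun d m => (Nat.card ((Fin d → k) ≃ₗ[k] (Fin d → k)) : ℂ)⁻¹ *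
      ∑ H : Matrix (Fin d) (Fin d) k,
      (Nat.card {x : Matrix (Fin a ⊕ Fin d) (Fin a ⊕ Fin d) k //
          IsFactorCoord μ ν z d H x ∧ x.toRows₂.rank = d} : ℂ) *
      (Nat.card {v : Matrix (Fin m) (Fin d) k // (∃ L : Matrix (Fin d) (Fin m) k, L * v = 1) ∧
          v.conjTranspose * v = H} : ℂ))
    (fun d _ => IsPolyInPow.const_mul (IsPolyInPow.sum _ fun H _ =>
      (isPolyInPow_card_injective_gram hk hs d H).const_mul _) _)
  refine h1.congr fun m => ?_
  have h2 := card_eq_sum_card_fiber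
    (fun g : {g // IsFactor μ ν z m g} => (g.1 - 1).toRows₂.rank) (D + 1) (fun g => by
      refine Nat.lt_succ_of_le (le_trans ?_ (hD m g.1 g.2))
      have : (g.1 - 1).toRows₂ = (Matrix.fromCols 0 1 : Matrix (Fin m) (Fin a ⊕ Fin m) k) *
          (g.1 - 1) := by
        conv_rhs => rw [← Matrix.fromRows_toRows (g.1 - 1)]
        rw [Matrix.fromCols_mul_fromRows, Matrix.zero_mul, Matrix.one_mul, zero_add]
      rw [this]
      exact Matrix.rank_mul_le_right _ _)
  rw [h2, Nat.cast_sum]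
  refine Finset.sum_congr rfl fun d _ => ?_
  rw [eq_inv_mul_iff_mul_eq₀ (card_linearEquiv_ne_zero d), mul_comm]
  have := card_isFactor_rank_mul μ ν z m d
  rw [Nat.card_sigma] at this
  simp only [Nat.card_prod] at this
  exact_mod_cast this.trans (Finset.sum_congr rfl fun _ _ => mul_comm _ _)

end Count
-- Rationality and integrality of interpolating polynomials
section Interpolation

/-- A polynomial in `(-q) ^ m` with natural values has rational coefficients. -/
theorem IsPolyInPow.exists_rat {q : ℕ} {N : ℕ → ℕ} (h : IsPolyInPow q fun m => (N m : ℂ)) :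
    ∃ p : ℚ[X], ∀ m, (N m : ℚ) = p.eval ((-(q : ℚ)) ^ m) := by
  obtain ⟨p, hp⟩ := h
  -- A `ℚ`-linear retraction of `ℂ` onto `ℚ`, applied to the coefficients, preserves the rational
  -- values at rational points.
  obtain ⟨π, hπ⟩ := LinearMap.exists_leftInverse_of_injective (Algebra.linearMap ℚ ℂ)
    (LinearMap.ker_eq_bot.2 (algebraMap ℚ ℂ).injective)
  have hπ' : ∀ x : ℚ, π (x : ℂ) = x := fun x => LinearMap.congr_fun hπ x
  have hmul : ∀ (c : ℂ) (x : ℚ), π (c * (x : ℂ)) = π c * x := by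
    intro c x
    have : c * (x : ℂ) = x • c := by rw [Rat.smul_def, mul_comm]
    rw [this, map_smul, smul_eq_mul, mul_comm]
  refine ⟨∑ i ∈ Finset.range (p.natDegree + 1), C (π (p.coeff i)) * X ^ i, fun m => ?_⟩
  have h1 : π (N m : ℂ) = π (p.eval ((-(q : ℂ)) ^ m)) := congrArg π (hp m)
  rw [show (N m : ℂ) = ((N m : ℚ) : ℂ) by push_cast; rfl, hπ', eval_eq_sum_range, map_sum] at h1
  rw [h1, eval_finsetSum]
  refine Finset.sum_congr rfl fun i _ => ?_
  have h2 : ((-(q : ℂ)) ^ m) ^ i = (((-(q : ℚ)) ^ m) ^ i : ℚ) := by push_cast; rfl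
  rw [h2, hmul]
  simp

/-- By pigeonhole two powers of `Q` agree modulo `D`. Dividing by the smaller one is allowed since
`Q⁻¹` is available, so `Q` and `D` need not be coprime. -/
theorem exists_pow_sub_one_eq (Q : ℤ) (hQ : Q ≠ 0) (D : ℤ) (hD : D ≠ 0) :
    ∃ φ : ℕ, 0 < φ ∧ ∃ t ∈ Algebra.adjoin ℤ ({(Q : ℚ), (Q : ℚ)⁻¹} : Set ℚ),
      (Q : ℚ) ^ φ - 1 = D * t := by
  have hne : NeZero D.natAbs := ⟨Int.natAbs_ne_zero.2 hD⟩
  obtain ⟨i, j, hij, h⟩ := Finite.exists_ne_map_eq_of_infinite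
    fun j : ℕ => ((Q ^ j : ℤ) : ZMod D.natAbs)
  wlog hlt : i < j generalizing i j
  · exact this j i hij.symm h.symm (lt_of_le_of_ne (not_lt.1 hlt) hij.symm)
  obtain ⟨s, hs⟩ := Int.natAbs_dvd.1 ((ZMod.intCast_eq_intCast_iff_dvd_sub _ _ _).1 h)
  have hQ' : (Q : ℚ) ≠ 0 := Int.cast_ne_zero.2 hQ
  refine ⟨j - i, by omega, s * ((Q : ℚ)⁻¹) ^ i, ?_, ?_⟩
  · exact mul_mem (intCast_mem _ _) (pow_mem (Algebra.subset_adjoin (by simp)) _)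
  · have h1 : (Q : ℚ) ^ j - Q ^ i = D * s := by exact_mod_cast hs
    obtain ⟨e, rfl⟩ := Nat.exists_eq_add_of_lt hlt
    have h2 : i + e + 1 - i = e + 1 := by omega
    rw [h2, ← mul_assoc, ← h1, inv_pow, eq_mul_inv_iff_mul_eq₀ (pow_ne_zero _ hQ')]
    ring

/-- A polynomial that is integral at all large quantum integers is in `ℛ_Q`. -/
theorem mem_quantumIntegerValued_of_forall_ge {Q : ℤ} (hQ : Q ≠ 0) (f : ℚ[X])
    (n₀ : ℕ) (hf : ∀ n : ℕ, n₀ ≤ n → ∃ c : ℤ, f.eval (quantumInt (Q : ℚ) (n : ℤ)) = c) :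
    f ∈ quantumIntegerValued (Q : ℚ) := by
  intro m
  set R := Algebra.adjoin ℤ ({(Q : ℚ), (Q : ℚ)⁻¹} : Set ℚ) with hR
  have hQ' : (Q : ℚ) ≠ 0 := Int.cast_ne_zero.2 hQ
  let g : ℚ[X] := f.comp (C ((Q - 1 : ℚ)⁻¹) * (X - 1))
  have hg : ∀ m : ℤ, f.eval (quantumInt (Q : ℚ) m) = g.eval ((Q : ℚ) ^ m) := by
    intro m
    simp only [g, quantumInt, eval_comp, eval_mul, eval_C, eval_sub, eval_X, eval_one]
    rw [div_eq_inv_mul]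
  obtain ⟨b, hbM, hb⟩ := IsLocalization.integerNormalization_spec (nonZeroDivisors ℤ) g
  set G := IsLocalization.integerNormalization (nonZeroDivisors ℤ) g
  have hD : b ≠ 0 := nonZeroDivisors.ne_zero hbM
  have hG : ∀ x : ℚ, aeval x G = (b : ℚ) * g.eval x := by
    intro x
    rw [← aeval_map_algebraMap ℚ x G, hb]
    simp
  obtain ⟨φ, hφ, t, ht, htφ⟩ := exists_pow_sub_one_eq Q hQ b hD
  have hzpow : ∀ j : ℤ, (Q : ℚ) ^ j ∈ R := by
    intro j
    obtain ⟨i, rfl | rfl⟩ := j.eq_nat_or_neg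
    · rw [zpow_natCast]
      exact pow_mem (Algebra.subset_adjoin (by simp)) _
    · rw [zpow_neg, zpow_natCast, ← inv_pow]
      exact pow_mem (Algebra.subset_adjoin (by simp)) _
  -- Shifting `m` by the multiple `φ * s` of the period reaches the range where integrality is
  -- known.
  let s : ℕ := m.natAbs + n₀
  have hm : m ≤ m + (φ * s : ℕ) ∧ (n₀ : ℤ) ≤ m + (φ * s : ℕ) := by
    have h1 : s ≤ φ * s := Nat.le_mul_of_pos_left _ hφ
    have h2 : s = m.natAbs + n₀ := rfl
    omega
  obtain ⟨N, hN⟩ := Int.eq_ofNat_of_zero_le ((Int.natCast_nonneg n₀).trans hm.2)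
  obtain ⟨c, hc⟩ := hf N (by omega)
  rw [hg, ← hN] at hc
  let x : R := ⟨(Q : ℚ) ^ m, hzpow m⟩
  let y : R := ⟨(Q : ℚ) ^ (m + (φ * s : ℕ)), hzpow _⟩
  let w : R := ⟨(Q : ℚ) ^ φ, by rw [← zpow_natCast]; exact hzpow _⟩
  have h1 : (y - x : R) ∣ aeval y G - aeval x G := by
    have := sub_dvd_eval_sub y x (G.map (algebraMap ℤ R))
    rwa [eval_map_algebraMap, eval_map_algebraMap] at this
  -- Thus `b` times the difference of the two values of `g` is divisible by `Q ^ φ - 1`, hence by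
  -- `b`, and the difference itself lies in `R`.
  have h2 : (w - 1 : R) ∣ y - x := by
    obtain ⟨v, hv⟩ := sub_one_dvd_pow_sub_one w s
    refine ⟨v * x, ?_⟩
    rw [← mul_assoc, ← hv]
    apply Subtype.ext
    change (Q : ℚ) ^ (m + (φ * s : ℕ)) - (Q : ℚ) ^ m = (((Q : ℚ) ^ φ) ^ s - 1) * (Q : ℚ) ^ m
    rw [zpow_add₀ hQ', zpow_natCast, pow_mul]
    ring
  obtain ⟨v, hv⟩ := h2.trans h1
  have hv' : aeval ((Q : ℚ) ^ (m + (φ * s : ℕ))) G - aeval ((Q : ℚ) ^ m) G =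
      ((Q : ℚ) ^ φ - 1) * (v : ℚ) := by
    have h3 : ∀ r : R, ((aeval r G : R) : ℚ) = aeval (r : ℚ) G := fun r =>
      (aeval_algHom_apply R.val r G).symm
    have := congrArg (Subtype.val : R → ℚ) hv
    rw [AddSubgroupClass.coe_sub, h3, h3] at this
    exact this
  rw [hG, hG, hc, htφ] at hv'
  have hb' : (b : ℚ) ≠ 0 := Int.cast_ne_zero.2 hD
  have hfin : g.eval ((Q : ℚ) ^ m) = c - t * v := by
    apply mul_left_cancel₀ hb'
    linear_combination -hv'
  rw [hg, hfin]
  exact sub_mem (intCast_mem _ _) (mul_mem ht v.2)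

end Interpolation

/-! ### The unitary group as a set of matrices -/

section Unitary

variable {k : Type*} [Field k] {q n : ℕ}

theorem hasModifiedType_unitary_iff [Finite k] (g : unitaryGrp k q n) (μ : Multipartition k) :
    HasModifiedType g.1.1 μ ↔ HasRanks μ (subOneRank g.1.1) :=
  hasModifiedType_iff_hasRanks g.1.isUnit μ

variable [StarRing k]

theorem hermitianForm_eq (hs : ∀ x : k, star x = x ^ q) (v w : Fin n → k) :
    hermitianForm q v w = star w ⬝ᵥ v := by
  rw [hermitianForm, dotProduct_comm]
  exact Finset.sum_congr rfl fun i _ => by rw [Pi.star_apply, hs]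

theorem mem_unitaryGrp_iff (hs : ∀ x : k, star x = x ^ q) (g : GL (Fin n) k) :
    g ∈ unitaryGrp k q n ↔ (g : Matrix (Fin n) (Fin n) k).conjTranspose * g.1 = 1 := by
  have h1 : ∀ v w : Fin n → k, hermitianForm q (g.1.mulVec v) (g.1.mulVec w) =
      star w ⬝ᵥ (g.1.conjTranspose * g.1).mulVec v := by
    intro v w
    rw [hermitianForm_eq hs, Matrix.star_mulVec, ← Matrix.dotProduct_mulVec, Matrix.mulVec_mulVec]
  change (∀ v w, hermitianForm q (g.1.mulVec v) (g.1.mulVec w) = hermitianForm q v w) ↔ _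
  simp only [h1, hermitianForm_eq hs]
  constructor
  · intro h
    ext i j
    have := h (Pi.single j 1) (Pi.single i 1)
    rw [← Pi.single_star, star_one, single_dotProduct, single_dotProduct, one_mul, one_mul,
      Matrix.mulVec_single_one] at this
    rw [Matrix.one_apply, Matrix.col_apply] at *
    rw [this, Pi.single_apply]
  · intro h v w
    rw [h, Matrix.one_mulVec]

/-- The unitary group as a set of matrices. -/
def unitaryEquiv (hs : ∀ x : k, star x = x ^ q) (n : ℕ) :
    unitaryGrp k q n ≃ {g : Matrix (Fin n) (Fin n) k // g.conjTranspose * g = 1} where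
  toFun g := ⟨g.1.1, (mem_unitaryGrp_iff hs g.1).1 g.2⟩
  invFun g := ⟨⟨g.1, g.1.conjTranspose, mul_eq_one_comm.1 g.2, g.2⟩,
    (mem_unitaryGrp_iff hs _).2 g.2⟩
  left_inv _ := Subtype.ext (Units.ext rfl)
  right_inv _ := rfl

theorem coe_inv_unitaryGrp (hs : ∀ x : k, star x = x ^ q)
    (g : unitaryGrp k q n) : ((g⁻¹ : unitaryGrp k q n) : GL (Fin n) k).1 = g.1.1.conjTranspose := by
  have h : g.1.1.conjTranspose * g.1.1 = 1 := (mem_unitaryGrp_iff hs g.1).1 g.2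
  have h2 : g.1.1 * ((g⁻¹ : unitaryGrp k q n) : GL (Fin n) k).1 = 1 := by
    rw [← Units.val_mul, ← Subgroup.coe_mul, mul_inv_cancel]
    rfl
  calc _ = g.1.1.conjTranspose * g.1.1 * ((g⁻¹ : unitaryGrp k q n) : GL (Fin n) k).1 := by
        rw [h, one_mul]
    _ = _ := by rw [mul_assoc, h2, mul_one]

end Unitary
-- Conjugation invariance and stabilisation of the counts
section FactorCount

variable {k : Type*} [Field k] {ι κ : Type*} [Fintype ι] [DecidableEq ι] [Fintype κ]
  [DecidableEq κ]

theorem subOneRank_congr {f : Matrix κ ι k} {f' : Matrix ι κ k} (h1 : f' * f = 1)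
    (h2 : f * f' = 1) {A : Matrix ι ι k} {B : Matrix κ κ k} (h : f * A = B * f) :
    subOneRank A = subOneRank B := by
  funext p
  have h3 : f * ((A - 1) * aeval A p) = (B - 1) * aeval B p * f := by
    rw [← Matrix.mul_assoc, Matrix.mul_sub, h, Matrix.mul_one, Matrix.mul_assoc (B - 1),
      ← mul_aeval_of_mul_eq h, ← Matrix.mul_assoc, Matrix.sub_mul B 1 f, Matrix.one_mul]
  rw [subOneRank, subOneRank, ← rank_mul_of_leftInverse ⟨f', h1⟩, h3,
    rank_mul_of_rightInverse ⟨f', h2⟩]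

theorem subOneRank_one (A : Matrix ι ι k) : subOneRank A 1 = (A - 1).rank := by
  rw [subOneRank, map_one, mul_one]

variable [StarRing k]

theorem exists_isometry_reindex (e : ι ≃ κ) (z : Matrix ι ι k) : ∃ f : Matrix κ ι k,
    f.conjTranspose * f = 1 ∧ f * f.conjTranspose = 1 ∧ f * z = Matrix.reindex e e z * f := by
  refine ⟨(1 : Matrix ι ι k).submatrix e.symm id, ?_, ?_, ?_⟩
  · rw [Matrix.conjTranspose_submatrix, Matrix.conjTranspose_one, Matrix.submatrix_mul_equiv]
    simp
  · rw [Matrix.conjTranspose_submatrix, Matrix.conjTranspose_one,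
      ← Matrix.submatrix_mul _ _ _ _ _ Function.bijective_id]
    simp
  · conv_lhs => rw [← Matrix.submatrix_id_id z]
    rw [← Matrix.submatrix_mul _ _ _ _ _ Function.bijective_id, Matrix.reindex_apply,
      Matrix.submatrix_mul_equiv, one_mul, mul_one]

theorem HasRanks.rank_sub_one [Finite k] {g : Matrix ι ι k} (hg : g.conjTranspose * g = 1)
    {μ : Multipartition k} (h : HasRanks μ (subOneRank g)) : (g - 1).rank = multiSize μ := by
  obtain ⟨f, h1, h2, h3⟩ := exists_isometry_reindex (Fintype.equivFin ι) g
  rw [subOneRank_congr h1 h2 h3] at h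
  rw [← subOneRank_one, subOneRank_congr h1 h2 h3, subOneRank_one]
  have hu : IsUnit (Matrix.reindex (Fintype.equivFin ι) (Fintype.equivFin ι) g) := by
    have h4 : IsUnit g := IsUnit.of_mul_eq_one _ (mul_eq_one_comm.1 hg)
    exact h4.map (Matrix.reindexAlgEquiv k k (Fintype.equivFin ι))
  exact ((hasModifiedType_iff_hasRanks hu μ).2 h).rank_sub_one

/-- The unitary `g` of modified type `μ` such that `g⁻¹ * z` has modified type `ν`. -/
def IsUnitaryFactor (μ ν : Multipartition k) (z g : Matrix ι ι k) : Prop :=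
  g.conjTranspose * g = 1 ∧ HasRanks μ (subOneRank g) ∧
    HasRanks ν (subOneRank (g.conjTranspose * z))

/-- The number of unitary `g` of modified type `μ` such that `g⁻¹ * z` has modified type `ν`. -/
noncomputable def factorCount (μ ν : Multipartition k) (z : Matrix ι ι k) : ℕ :=
  Nat.card {g // IsUnitaryFactor μ ν z g}

theorem IsUnitaryFactor.conj {μ ν : Multipartition k} {z g : Matrix ι ι k} {w : Matrix κ κ k}
    {f : Matrix κ ι k} (h1 : f.conjTranspose * f = 1) (h2 : f * f.conjTranspose = 1)
    (h : f * z = w * f) (hg : IsUnitaryFactor μ ν z g) :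
    IsUnitaryFactor μ ν w (f * g * f.conjTranspose) := by
  have hc : ∀ A : Matrix ι ι k, f.conjTranspose * (f * A) = A := fun A => by
    rw [← Matrix.mul_assoc, h1, Matrix.one_mul]
  refine ⟨?_, ?_, ?_⟩
  · have : (f * g * f.conjTranspose).conjTranspose * (f * g * f.conjTranspose) =
        f * ((g.conjTranspose * (f.conjTranspose * (f * g))) * f.conjTranspose) := by
      simp only [Matrix.conjTranspose_mul, Matrix.conjTranspose_conjTranspose, Matrix.mul_assoc]
    rw [this, hc, hg.1, Matrix.one_mul, h2]
  · rw [← subOneRank_congr h1 h2 (A := g)]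
    · exact hg.2.1
    · rw [Matrix.mul_assoc, h1, Matrix.mul_one]
  · rw [← subOneRank_congr h1 h2 (A := g.conjTranspose * z)]
    · exact hg.2.2
    · rw [Matrix.mul_assoc, ← h]
      simp only [Matrix.conjTranspose_mul, Matrix.conjTranspose_conjTranspose, Matrix.mul_assoc, hc]

theorem factorCount_congr (μ ν : Multipartition k) {z : Matrix ι ι k} {w : Matrix κ κ k}
    {f : Matrix κ ι k} (h1 : f.conjTranspose * f = 1) (h2 : f * f.conjTranspose = 1)
    (h : f * z = w * f) : factorCount μ ν z = factorCount μ ν w := by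
  have h' : f.conjTranspose * w = z * f.conjTranspose := by
    calc f.conjTranspose * w = f.conjTranspose * (w * f) * f.conjTranspose := by
          rw [Matrix.mul_assoc, Matrix.mul_assoc, h2, Matrix.mul_one]
      _ = _ := by rw [← h, ← Matrix.mul_assoc, h1, Matrix.one_mul]
  refine Nat.card_congr
    { toFun := fun g => ⟨_, g.2.conj h1 h2 h⟩
      invFun := fun g => ⟨f.conjTranspose * g.1 * f, ?_⟩
      left_inv := fun g => Subtype.ext ?_
      right_inv := fun g => Subtype.ext ?_ }
  · have := g.2.conj (f := f.conjTranspose) (by rwa [Matrix.conjTranspose_conjTranspose])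
      (by rwa [Matrix.conjTranspose_conjTranspose]) h'
    rwa [Matrix.conjTranspose_conjTranspose] at this
  · change f.conjTranspose * (f * g.1 * f.conjTranspose) * f = g.1
    calc _ = (f.conjTranspose * f) * g.1 * (f.conjTranspose * f) := by
          simp only [Matrix.mul_assoc]
      _ = _ := by rw [h1, Matrix.one_mul, Matrix.mul_one]
  · change f * (f.conjTranspose * g.1 * f) * f.conjTranspose = g.1
    calc _ = (f * f.conjTranspose) * g.1 * (f * f.conjTranspose) := by
          simp only [Matrix.mul_assoc]
      _ = _ := by rw [h2, Matrix.one_mul, Matrix.mul_one]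

theorem stabilize_unitary {a : ℕ} (m : ℕ) {z : Matrix (Fin a) (Fin a) k}
    (hz : z.conjTranspose * z = 1) :
    (stabilize m z).conjTranspose * stabilize m z = 1 := by
  simp [stabilize, Matrix.fromBlocks_conjTranspose, Matrix.fromBlocks_multiply, hz]

/-- The inclusion of the first block is a frame with Gram matrix `1`. This is why modified types are
stable in `n`. -/
theorem subOneRank_stabilize {a : ℕ} (m : ℕ) (z : Matrix (Fin a) (Fin a) k) :
    subOneRank (stabilize m z) = subOneRank z := by
  funext p
  let f : Matrix (Fin a ⊕ Fin m) (Fin a) k := Matrix.fromRows 1 0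
  have hf : f.conjTranspose * f = 1 := by
    simp [f, Matrix.conjTranspose_fromRows_eq_fromCols_conjTranspose, Matrix.fromCols_mul_fromRows]
  have h1 : stabilize m z = 1 + f * (z - 1) * f.conjTranspose := by
    simp [f, stabilize, Matrix.conjTranspose_fromRows_eq_fromCols_conjTranspose,
      Matrix.fromRows_mul, Matrix.mul_fromCols, ← Matrix.fromBlocks_one]
    ext (i | i) (j | j) <;> simp [Matrix.one_apply]
  rw [h1, subOneRank_frame ⟨_, hf⟩, hf, frameRank, one_mul, add_sub_cancel, subOneRank]

/-- `w` and `z ⊕ 1` have the same size and modified type, so they are similar, hence unitarily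
similar, and conjugation matches their factorisations. -/
theorem factorCount_eq_stabilize [Finite k] (hθ : ∃ t : k, t - star t ≠ 0)
    (μ ν : Multipartition k) {l : Multipartition k} {a m : ℕ} {z : Matrix (Fin a) (Fin a) k}
    (hz : z.conjTranspose * z = 1) (hzl : HasRanks l (subOneRank z))
    {w : Matrix (Fin (a + m)) (Fin (a + m)) k}
    (hw : w.conjTranspose * w = 1) (hwl : HasRanks l (subOneRank w)) :
    factorCount μ ν w = Nat.card {g // IsFactor μ ν z m g} := by
  obtain ⟨f, h1, h2, h3⟩ := exists_isometry_reindex (finSumFinEquiv (m := a) (n := m))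
    (stabilize m z)
  generalize Matrix.reindex _ _ _ = y at h3
  have hyl : HasRanks l (subOneRank y) := by
    rwa [← subOneRank_congr h1 h2 h3, subOneRank_stabilize]
  have hy : y = f * stabilize m z * f.conjTranspose := by
    rw [h3, Matrix.mul_assoc, h2, Matrix.mul_one]
  have hyu : y.conjTranspose * y = 1 := by
    have : y.conjTranspose * y = f * ((stabilize m z).conjTranspose * (f.conjTranspose * f) *
        stabilize m z) * f.conjTranspose := by
      rw [hy]
      simp only [Matrix.conjTranspose_mul, Matrix.conjTranspose_conjTranspose, Matrix.mul_assoc]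
    rw [this, h1, Matrix.mul_one, stabilize_unitary m hz, Matrix.mul_one, h2]
  have hu : ∀ {g : Matrix (Fin (a + m)) (Fin (a + m)) k}, g.conjTranspose * g = 1 → IsUnit g :=
    fun hg => IsUnit.of_mul_eq_one _ (mul_eq_one_comm.1 hg)
  obtain ⟨P, hP⟩ := ((hasModifiedType_iff_hasRanks (hu hw) l).2 hwl).exists_conj
    ((hasModifiedType_iff_hasRanks (hu hyu) l).2 hyl)
  obtain ⟨U, hU, hUw⟩ := exists_unitary_conj hθ hw hyu P.isUnit hP
  rw [factorCount_congr μ ν hU (mul_eq_one_comm.1 hU) hUw, ← factorCount_congr μ ν h1 h2 h3]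
  rfl

end FactorCount

/-! ### Structure constants as polynomials in `[n]` -/

section StructurePolynomial

variable {k : Type*} [Field k] [Fintype k] [StarRing k] {q : ℕ}

/-- The structure constants are interpolated by quantum integer-valued polynomials. -/
theorem exists_structurePolynomial (hk : Fintype.card k = q ^ 2) (hs : ∀ x : k, star x = x ^ q)
    (μ ν l : Multipartition k) : ∃ f ∈ quantumIntegerValued (-(q : ℚ)),
      ∀ (n : ℕ) (z : Matrix (Fin n) (Fin n) k), z.conjTranspose * z = 1 →
        HasRanks l (subOneRank z) →
        (factorCount μ ν z : ℚ) = f.eval (quantumInt (-(q : ℚ)) (n : ℤ)) := by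
  classical
  have hθ := exists_star_sub_self_ne_zero hk hs
  have hq := two_le_of_card hk
  by_cases hex : ∃ (n : ℕ) (z : Matrix (Fin n) (Fin n) k), z.conjTranspose * z = 1 ∧
      HasRanks l (subOneRank z)
  swap
  · exact ⟨0, zero_mem _, fun n z hz hl => (hex ⟨n, z, hz, hl⟩).elim⟩
  -- By minimality of the size `a` of `z`, every realisation of `l` has size `a + m` for some
  -- natural `m`.
  obtain ⟨z, hz, hzl⟩ := Nat.find_spec hex
  have hmin : ∀ {n : ℕ} {w : Matrix (Fin n) (Fin n) k}, w.conjTranspose * w = 1 →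
      HasRanks l (subOneRank w) → Nat.find hex ≤ n := fun hw hwl =>
    Nat.find_min' hex ⟨_, hw, hwl⟩
  generalize Nat.find hex = a at z hz hzl hmin
  obtain ⟨p, hp⟩ := (isPolyInPow_card_isFactor hk hs μ ν z (multiSize μ)
    (fun m g hg => (HasRanks.rank_sub_one hg.1 hg.2.1).le)).exists_rat
  have hQ : (-(q : ℚ)) ≠ 0 := neg_ne_zero.2 (Nat.cast_ne_zero.2 (by omega))
  have hQ1 : (-(q : ℚ)) - 1 ≠ 0 := by
    have : (2 : ℚ) ≤ q := by exact_mod_cast hq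
    intro h
    linarith
  -- With `Q = -q`, `1 + (Q - 1) * [n] = Q ^ n`; the factor `Q ^ (-a)` turns this into `Q ^ m` for
  -- `n = a + m`.
  have key : ∀ m : ℕ, (p.comp (C ((-(q : ℚ)) ^ a)⁻¹ * (1 + C (-(q : ℚ) - 1) * X))).eval
      (quantumInt (-(q : ℚ)) ((a + m : ℕ) : ℤ)) = (Nat.card {g // IsFactor μ ν z m g} : ℚ) := by
    intro m
    rw [hp, eval_comp]
    congr 1
    simp only [quantumInt, eval_mul, eval_C, eval_add, eval_one, eval_X]
    rw [mul_div_cancel₀ _ hQ1, add_sub_cancel, zpow_natCast, pow_add,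
      inv_mul_cancel_left₀ (pow_ne_zero _ hQ)]
  refine ⟨p.comp (C ((-(q : ℚ)) ^ a)⁻¹ * (1 + C (-(q : ℚ) - 1) * X)), ?_, ?_⟩
  · have h := mem_quantumIntegerValued_of_forall_ge (Q := -(q : ℤ))
      (neg_ne_zero.2 (Nat.cast_ne_zero.2 (by omega)))
      (p.comp (C ((-(q : ℚ)) ^ a)⁻¹ * (1 + C (-(q : ℚ) - 1) * X))) a
    rw [Int.cast_neg, Int.cast_natCast] at h
    refine h fun n hn => ?_
    obtain ⟨m, rfl⟩ := Nat.exists_eq_add_of_le hn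
    exact ⟨Nat.card {g // IsFactor μ ν z m g}, by rw [key, Int.cast_natCast]⟩
  · intro n w hw hwl
    obtain ⟨m, rfl⟩ := Nat.exists_eq_add_of_le (hmin hw hwl)
    rw [key, factorCount_eq_stabilize hθ μ ν hz hzl hw hwl]

end StructurePolynomial

/-! ### Finitely many types occur in a product -/

section Finiteness

variable {k : Type*} [Field k]

theorem rank_add_le {ι κ : Type*} [Fintype κ] (A B : Matrix ι κ k) :
    (A + B).rank ≤ A.rank + B.rank := by
  rw [Matrix.rank, Matrix.mulVecLin_add]
  refine (Submodule.finrank_mono (LinearMap.range_add_le _ _)).trans ?_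
  exact Submodule.finrank_add_le_finrank_add_finrank _ _

variable [Finite k] [StarRing k]

/-- Only finitely many modified types occur in unitary matrices that are products of two unitary
matrices of given modified types. -/
theorem finite_setOf_factorCount_ne_zero (μ ν : Multipartition k) :
    {l : Multipartition k | ∃ (n : ℕ) (z : Matrix (Fin n) (Fin n) k), z.conjTranspose * z = 1 ∧
      HasRanks l (subOneRank z) ∧ factorCount μ ν z ≠ 0}.Finite := by
  -- A modified type is determined by a Gram matrix and coordinates of size `c = rank (z - 1)`, and
  -- over a finite field there are finitely many of these for bounded `c`.
  refine Set.Finite.subset (s := ⋃ c ∈ Set.Iic (multiSize μ + multiSize ν),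
    ⋃ G : Matrix (Fin c) (Fin c) k, ⋃ x : Matrix (Fin c) (Fin c) k,
      {l : Multipartition k | HasRanks l (frameRank G x)}) ?_ ?_
  · refine Set.Finite.biUnion (Set.finite_Iic _) fun c _ => Set.finite_iUnion fun G =>
      Set.finite_iUnion fun x => Set.Subsingleton.finite fun l hl l' hl' => hl.unique hl'
  · rintro l ⟨n, z, hz, hl, h0⟩
    obtain ⟨⟨g, hg⟩⟩ := (Nat.card_ne_zero.1 h0).1
    have hle : (z - 1).rank ≤ multiSize μ + multiSize ν := by
      have hg' : g * g.conjTranspose = 1 := mul_eq_one_comm.1 hg.1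
      have hgz : (g.conjTranspose * z).conjTranspose * (g.conjTranspose * z) = 1 := by
        rw [Matrix.conjTranspose_mul, Matrix.conjTranspose_conjTranspose, mul_assoc,
          ← mul_assoc g, hg', one_mul, hz]
      have h1 : z - 1 = (g - 1) + g * (g.conjTranspose * z - 1) := by
        rw [mul_sub, ← mul_assoc, hg', one_mul, mul_one]
        abel
      rw [h1]
      refine (rank_add_le _ _).trans (add_le_add (HasRanks.rank_sub_one hg.1 hg.2.1).le ?_)
      exact (Matrix.rank_mul_le_right _ _).trans (HasRanks.rank_sub_one hgz hg.2.2).le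
    obtain ⟨u, P, hu, hP⟩ := exists_rank_factorization (z - 1)
    obtain ⟨x, hx⟩ := exists_frame_eq hu hz hP
    simp only [Set.mem_iUnion]
    refine ⟨_, hle, u.conjTranspose * u, x, ?_⟩
    have := funext (subOneRank_frame hu x)
    rw [← hx] at this
    change HasRanks l _
    rwa [← this]

end Finiteness
-- Class sums and structure constants in the group algebra
section GroupAlgebra

/-- The sum of the elements of a set in the rational group algebra. -/
noncomputable def setSum {G : Type*} [Group G] [Finite G] (S : Set G) : MonoidAlgebra ℚ G :=
  ∑ g ∈ S.toFinite.toFinset, MonoidAlgebra.of ℚ _ g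

theorem coeff_setSum {G : Type*} [Group G] [Finite G] (S : Set G) [DecidablePred (· ∈ S)] (z : G) :
    (setSum S).coeff z = if z ∈ S then 1 else 0 := by
  classical
  rw [setSum, MonoidAlgebra.coeff_sum, Finsupp.finsetSum_apply]
  simp [MonoidAlgebra.of_apply, Finsupp.single_apply]

theorem coeff_setSum_mul {G : Type*} [Group G] [Finite G] (S T : Set G) (z : G) :
    (setSum S * setSum T).coeff z = (Nat.card {g : G // g ∈ S ∧ g⁻¹ * z ∈ T} : ℚ) := by
  classical
  have := Fintype.ofFinite G
  have h : ∀ g : G, (MonoidAlgebra.of ℚ G g * setSum T).coeff z =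
      if g⁻¹ * z ∈ T then 1 else 0 := fun g => by
    rw [← coeff_setSum T, MonoidAlgebra.of_apply,
      MonoidAlgebra.coeff_single_mul_eq_mul_coeff (g⁻¹ * z) fun _ _ => eq_inv_mul_iff_mul_eq.symm,
      one_mul]
  rw [setSum, Finset.sum_mul, MonoidAlgebra.coeff_sum, Finsupp.finsetSum_apply,
    Finset.sum_congr rfl fun g _ => h g, Finset.sum_boole, Nat.card_eq_fintype_card,
    Fintype.card_subtype]
  congr 2
  ext g
  simp

theorem centerToRat_classSum {k : Type*} [Field k] [Finite k] (q n : ℕ) (μ : Multipartition k) :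
    centerToRat (unitaryGrp k q n) (classSum q n μ) =
      setSum {g : unitaryGrp k q n | HasModifiedType g.1.1 μ} := by
  rw [centerToRat, RingHom.comp_apply]
  change MonoidAlgebra.mapRingHom _ _ (modifiedTypeSum q n μ) = _
  rw [modifiedTypeSum, setSum, map_sum]
  refine Finset.sum_congr rfl fun g _ => ?_
  rw [MonoidAlgebra.of_apply, MonoidAlgebra.of_apply, MonoidAlgebra.mapRingHom_single, map_one]

end GroupAlgebra

section StructureConstants

variable {k : Type*} [Field k] [Fintype k] [StarRing k] {q : ℕ}

theorem coeff_classSum_mul (hs : ∀ x : k, star x = x ^ q) (n : ℕ) (μ ν : Multipartition k)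
    (z : unitaryGrp k q n) :
    (centerToRat (unitaryGrp k q n) (classSum q n μ * classSum q n ν)).coeff z =
      (factorCount μ ν z.1.1 : ℚ) := by
  rw [map_mul, centerToRat_classSum, centerToRat_classSum, coeff_setSum_mul, Nat.cast_inj]
  have h : ∀ g : unitaryGrp k q n, (g ∈ {g : unitaryGrp k q n | HasModifiedType g.1.1 μ} ∧
      g⁻¹ * z ∈ {g : unitaryGrp k q n | HasModifiedType g.1.1 ν}) ↔
      IsUnitaryFactor μ ν z.1.1 (unitaryEquiv hs n g).1 := by
    intro g
    rw [Set.mem_ofPred_eq, Set.mem_ofPred_eq, hasModifiedType_unitary_iff,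
      hasModifiedType_unitary_iff, Subgroup.coe_mul, Units.val_mul, coe_inv_unitaryGrp hs]
    exact (and_iff_right (unitaryEquiv hs n g).2).symm
  exact Nat.card_congr
    { toFun := fun g => ⟨_, (h g.1).1 g.2⟩
      invFun := fun g => ⟨(unitaryEquiv hs n).symm ⟨g.1, g.2.1⟩, (h _).2 (by
        rw [Equiv.apply_symm_apply]
        exact g.2)⟩
      left_inv := fun g => Subtype.ext ((unitaryEquiv hs n).symm_apply_apply g.1)
      right_inv := fun g => rfl }

/-- Every element of the unitary group has a modified type, which is invariant under `*`. -/
theorem exists_hasRanks (hs : ∀ x : k, star x = x ^ q) {n : ℕ} (z : unitaryGrp k q n) :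
    ∃ l : StarMultipartition k q, HasRanks l.1 (subOneRank z.1.1) := by
  obtain ⟨μ, hμ⟩ := exists_hasType z.1.isUnit
  have h := hμ.hasRanks_modify
  exact ⟨⟨_, isStarInvariant_of_hasRanks hs ((mem_unitaryGrp_iff hs z.1).1 z.2) h⟩, h⟩

/-- Compare coefficients at each `z`: modified types are unique, so exactly one class sum contains
`z`. -/
theorem exists_structureConstants (hk : Fintype.card k = q ^ 2) (hs : ∀ x : k, star x = x ^ q)
    (μ ν : StarMultipartition k q) :
    ∃ r : StarMultipartition k q →₀ quantumIntegerValued (-(q : ℚ)), ∀ n : ℕ,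
      centerToRat (unitaryGrp k q n) (classSum q n μ.1 * classSum q n ν.1) =
        r.sum fun l c => ((c : ℚ[X]).eval (quantumInt (-(q : ℚ)) (n : ℤ))) •
          centerToRat (unitaryGrp k q n) (classSum q n l.1) := by
  classical
  choose f hf hfz using exists_structurePolynomial hk hs μ.1 ν.1
  have hfin := finite_setOf_factorCount_ne_zero μ.1 ν.1
  set Λ := {l : Multipartition k | ∃ (n : ℕ) (z : Matrix (Fin n) (Fin n) k),
    z.conjTranspose * z = 1 ∧ HasRanks l (subOneRank z) ∧ factorCount μ.1 ν.1 z ≠ 0} with hΛ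
  have hfin' : {l : StarMultipartition k q | l.1 ∈ Λ}.Finite :=
    hfin.preimage Subtype.val_injective.injOn
  let F : StarMultipartition k q → quantumIntegerValued (-(q : ℚ)) :=
    -- Setting the coefficient to zero outside `Λ` gives finite support and changes no value that
    -- matters: there all factorisation counts vanish.
    fun l => if l.1 ∈ Λ then ⟨f l.1, hf l.1⟩ else 0
  have hF : (Function.support F).Finite := hfin'.subset fun l hl => by
    by_contra h
    exact hl (if_neg h)
  refine ⟨Finsupp.ofSupportFinite F hF, fun n => ?_⟩
  ext z
  obtain ⟨l, hl⟩ := exists_hasRanks hs z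
  have hz := (mem_unitaryGrp_iff hs z.1).1 z.2
  have hzl : z ∈ {g : unitaryGrp k q n | HasModifiedType g.1.1 l.1} :=
    (hasModifiedType_unitary_iff z _).2 hl
  rw [coeff_classSum_mul hs, Finsupp.sum, MonoidAlgebra.coeff_sum, Finsupp.finsetSum_apply,
    Finset.sum_eq_single l]
  · rw [MonoidAlgebra.coeff_smul_apply, centerToRat_classSum, coeff_setSum, if_pos hzl,
      smul_eq_mul, mul_one, Finsupp.ofSupportFinite_coe]
    by_cases h : l.1 ∈ Λ
    · simp only [F, if_pos h]
      exact hfz l.1 n z.1.1 hz hl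
    · simp only [F, if_neg h]
      have h0 : factorCount μ.1 ν.1 z.1.1 = 0 := by
        by_contra h0
        exact h ⟨n, z.1.1, hz, hl, h0⟩
      simp [h0]
  · intro l' _ hne
    rw [MonoidAlgebra.coeff_smul_apply, centerToRat_classSum, coeff_setSum, if_neg, smul_zero]
    intro h
    exact hne (Subtype.ext (((hasModifiedType_unitary_iff z _).1 h).unique hl))
  · intro h
    rw [Finsupp.notMem_support_iff.1 h]
    simp

end StructureConstants
end StableUnitary

theorem theorem8p1 (q : ℕ) (k : Type*) [Field k] [Fintype k] (hk : Fintype.card k = q ^ 2) :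
    ∃ r : StableUnitary.StarMultipartition k q → StableUnitary.StarMultipartition k q →
        StableUnitary.StarMultipartition k q →₀ StableUnitary.quantumIntegerValued (-(q : ℚ)),
      (∀ (n : ℕ) (μ ν : StableUnitary.StarMultipartition k q),
        StableUnitary.centerToRat (StableUnitary.unitaryGrp k q n)
            (StableUnitary.classSum q n μ.1 * StableUnitary.classSum q n ν.1) =
          (r μ ν).sum fun l c =>
            ((c : Polynomial ℚ).eval (StableUnitary.quantumInt (-(q : ℚ)) (n : ℤ))) •
              StableUnitary.centerToRat (StableUnitary.unitaryGrp k q n)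
                (StableUnitary.classSum q n l.1)) ∧
      ∀ μ ν l : StableUnitary.StarMultipartition k q, ∃ p : Polynomial ℚ, ∀ n : ℕ,
        ((r μ ν l : Polynomial ℚ)).eval (StableUnitary.quantumInt (-(q : ℚ)) (n : ℤ)) =
          p.eval ((-(q : ℚ)) ^ n) := by
  let _ : StarRing k := StableUnitary.starRingOfCard hk
  have hs : ∀ x : k, star x = x ^ q := fun _ => rfl
  choose r hr using StableUnitary.exists_structureConstants hk hs
  -- The last claim holds for any polynomial in `[n]`, since `[n] = (Q ^ n - 1) / (Q - 1)` is itself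
  -- a polynomial in `Q ^ n`, where `Q = -q`.
  refine ⟨r, fun n μ ν => hr μ ν n, fun μ ν l =>
    ⟨(r μ ν l : ℚ[X]).comp (C ((-(q : ℚ) - 1)⁻¹) * (X - 1)), fun n => ?_⟩⟩
  rw [eval_comp, StableUnitary.quantumInt, zpow_natCast, div_eq_inv_mul]
  simp
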